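/- Let $(\Omega,\mathcal G,\mathbb P)$ be a probability space, $\mathbb X\subseteq\mathbb R$, $n\ge 0$ and $\sigma_1,\dots,\sigma_n>0$. Let $X\in L^2(\Omega,\mathcal G,\mathbb P)$ take values in $\mathbb X$ and have law $\nu$ on $(\mathbb X,\mathcal B(\mathbb X))$. Let $(\beta^{(i)}_t)_{0\le t\le 1}$, $i=1,\dots,n$, be standard Brownian bridges (centred Gaussian processes with covariance $\min(s,t)-st$ and almost surely continuous paths) such that $X,\beta^{(1)},\dots,\beta^{(n)}$ are mutually independent, and put $$\xi^{(i)}_t=tX+\sigma_i\beta^{(i)}_t,\qquad t\in[0,1],\ i=1,\dots,n,$$ writing also $\xi^{(i)}(t)$ for $\xi^{(i)}_t$. Let $(\tilde J_t)_{0\le t\le 1}$ be a càdlàg jump process with state space $\{0,1\}^n$ (its switching times form a random point field; source $i$ is active at time $t$ if $\tilde J^{(i)}_t=1$) that is independent of $(\xi^{(1)},\dots,\xi^{(n)})$, and let $J_t=\operatorname{diag}(\tilde J^{(1)}_t,\dots,\tilde J^{(n)}_t)$. Let $$\mathcal F^0_t=\sigma\big((J_u\xi_u)_{0\le u\le t},\,(J_u)_{0\le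 u\le t},\,X\mathbf 1_{\{t=1\}}\big),\qquad \xi_u=(\xi^{(1)}_u,\dots,\xi^{(n)}_u)^{\top},$$ and let $(\mathcal F_t)_{0\le t\le1}$ be the right-continuous filtration obtained from $(\mathcal F^0_t)$ by adding all $\mathbb P$-null events and passing to the right-continuation. Let $$\tau^{(i)}_t=0\vee\sup\{u\in[0,t]:J^{(i,i)}_u=1\}\qquad(\sup\emptyset=-\infty)$$ be the last time up to $t$ at which source $i$ was active, and for $x,y\in\mathbb R$, $t\in[0,1)$, $\sigma>0$ let $$h(x,y,t,\sigma)=\exp\left\{\frac{xy-tx^2/2}{\sigma^2(1-t)}\right\}.$$ Then, for every $t\in[0,1)$, the $\mathcal F_t$-conditional distribution of $X$ is $$\mathbb P[X\in\mathrm dx\mid\mathcal F_t]=\frac{\prod_{i=1}^n h\big(x,\xi^{(i)}(\tau^{(i)}_t),\tau^{(i)}_t,\sigma_i\big)\,\nu(\mathrm dx)}{\int_{\mathbb X}\prod_{i=1}^n h\big(x',\xi^{(i)}(\tau^{(i)}_t),\tau^{(i)}_t,\sigma_i\big)\,\nu(\mathrm dx')}.$$ That is, almost surely the right-hand side is a well-defined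 probability measure on $\mathbb X$ (the normalising integral is positive and finite), and for every $A\in\mathcal B(\mathbb X)$ its value on $A$ is a version of $\mathbb P[X\in A\mid\mathcal F_t]$. The same formula holds with $\mathcal F^0_t$ in place of $\mathcal F_t$. -/

import Mathlib

open MeasureTheory ProbabilityTheory Filter Topology
open scoped ENNReal

namespace ModulatedInfo

noncomputable section

/-- `β` is a standard Brownian bridge on `[0,1]`: a centred Gaussian process with covariance
`(s, t) ↦ min s t - s t` and almost surely continuous paths. -/
structure IsBrownianBridge {Ω : Type*} [MeasurableSpace Ω] (P : Measure Ω)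
    (β : unitInterval → Ω → ℝ) : Prop where
  measurable : ∀ t, Measurable (β t)
  gaussian : IsGaussianProcess β P
  mean : ∀ t, ∫ ω, β t ω ∂P = 0
  covariance : ∀ s t : unitInterval,
    covariance (β s) (β t) P = min (s : ℝ) (t : ℝ) - (s : ℝ) * (t : ℝ)
  continuous : ∀ᵐ ω ∂P, Continuous fun t => β t ω

/-- The Brownian bridge information process `ξ⁽ⁱ⁾ₜ = t X + σᵢ β⁽ⁱ⁾ₜ`. -/
def infoProcess {Ω : Type*} {n : ℕ} (X : Ω → ℝ) (σ : Fin n → ℝ)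
    (β : Fin n → unitInterval → Ω → ℝ) (i : Fin n) (t : unitInterval) (ω : Ω) : ℝ :=
  (t : ℝ) * X ω + σ i * β i t ω

/-- Right-continuous with left limits, on the time interval `[0,1]`.
At `t = 0` the left limit is vacuous, at `t = 1` the right-continuity is. -/
def IsCadlag {E : Type*} [TopologicalSpace E] (f : unitInterval → E) : Prop :=
  ∀ t, ContinuousWithinAt f (Set.Ici t) t ∧ ∃ l, Tendsto f (𝓝[<] t) (𝓝 l)

/-- `J` is a càdlàg jump process with state space `{0,1}ⁿ`: it describes which of the `n` sources
are switched on. Such a path has only finitely many jumps in `[0,1]`; the switching times of the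
coordinates are the points of a random point field. -/
structure IsSwitchingProcess {Ω : Type*} [MeasurableSpace Ω] {n : ℕ} (P : Measure Ω)
    (J : unitInterval → Ω → Fin n → ℝ) : Prop where
  measurable : ∀ t, Measurable (J t)
  zero_or_one : ∀ t ω i, J t ω i = 0 ∨ J t ω i = 1
  cadlag : ∀ᵐ ω ∂P, IsCadlag fun t => J t ω

/-- The diagonal matrix-valued process with diagonal `J`. -/
def switchMatrix {Ω : Type*} {n : ℕ} (J : unitInterval → Ω → Fin n → ℝ)
    (t : unitInterval) (ω : Ω) : Matrix (Fin n) (Fin n) ℝ :=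
  Matrix.diagonal (J t ω)

/-- The modulated information process `Jₜ ξₜ` (matrix times vector). -/
def modulatedProcess {Ω : Type*} {n : ℕ} (J : unitInterval → Ω → Fin n → ℝ)
    (ξ : Fin n → unitInterval → Ω → ℝ) (t : unitInterval) (ω : Ω) : Fin n → ℝ :=
  (switchMatrix J t ω).mulVec fun i => ξ i t ω

/-- The σ-algebra `σ((J_u ξ_u)_{u ≤ t}, (J_u)_{u ≤ t}, X 1_{t = 1})`. -/
@[reducible] def modulatedSigma {Ω : Type*} {n : ℕ} (X : Ω → ℝ) (J : unitInterval → Ω → Fin n → ℝ)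
    (ξ : Fin n → unitInterval → Ω → ℝ) (t : unitInterval) : MeasurableSpace Ω :=
  (⨆ u : unitInterval, ⨆ _ : u ≤ t,
      MeasurableSpace.comap (modulatedProcess J ξ u) inferInstance) ⊔
    (⨆ u : unitInterval, ⨆ _ : u ≤ t, ⨆ i : Fin n, ⨆ j : Fin n,
      MeasurableSpace.comap (fun ω => switchMatrix J u ω i j) inferInstance) ⊔
    MeasurableSpace.comap (fun ω => if t = 1 then X ω else 0) inferInstance

theorem modulatedSigma_mono {Ω : Type*} {n : ℕ} (X : Ω → ℝ)
    (J : unitInterval → Ω → Fin n → ℝ) (ξ : Fin n → unitInterval → Ω → ℝ) :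
    Monotone (modulatedSigma X J ξ) := by
  intro s t hst
  refine sup_le_sup (sup_le_sup ?_ ?_) ?_
  · exact iSup₂_le fun u hu => le_iSup₂_of_le u (hu.trans hst) le_rfl
  · exact iSup₂_le fun u hu => le_iSup₂_of_le u (hu.trans hst) le_rfl
  · by_cases hs : s = 1
    · have ht : t = 1 := le_antisymm unitInterval.le_one' (hs ▸ hst)
      rw [hs, ht]
    · simp [hs]

theorem modulatedSigma_le {Ω : Type*} [mΩ : MeasurableSpace Ω] {n : ℕ} {X : Ω → ℝ}
    {J : unitInterval → Ω → Fin n → ℝ} {ξ : Fin n → unitInterval → Ω → ℝ}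
    (hX : Measurable X) (hJ : ∀ t, Measurable (J t)) (hξ : ∀ i t, Measurable (ξ i t))
    (t : unitInterval) : modulatedSigma X J ξ t ≤ mΩ := by
  have hJi : ∀ u i, Measurable fun ω => J u ω i := fun u i => measurable_pi_iff.1 (hJ u) i
  refine sup_le (sup_le ?_ ?_) ?_
  · refine iSup₂_le fun u _ => Measurable.comap_le ?_
    refine measurable_pi_iff.2 fun i => ?_
    simp only [modulatedProcess, switchMatrix, Matrix.mulVec_diagonal]
    exact (hJi u i).mul (hξ i u)
  · refine iSup₂_le fun u _ => iSup₂_le fun i j => Measurable.comap_le ?_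
    by_cases hij : i = j
    · subst hij
      simpa [switchMatrix] using hJi u i
    · simp [switchMatrix, Matrix.diagonal_apply_ne _ hij]
  · refine Measurable.comap_le ?_
    by_cases ht : t = 1 <;> simp [ht, hX]

/-- The filtration `(σ((J_u ξ_u)_{u ≤ t}, (J_u)_{u ≤ t}, X 1_{t = 1}))ₜ`, before augmentation. -/
def rawFiltration {Ω : Type*} [mΩ : MeasurableSpace Ω] {n : ℕ} (X : Ω → ℝ)
    (J : unitInterval → Ω → Fin n → ℝ) (ξ : Fin n → unitInterval → Ω → ℝ)
    (hX : Measurable X) (hJ : ∀ t, Measurable (J t)) (hξ : ∀ i t, Measurable (ξ i t)) :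
    Filtration unitInterval mΩ where
  seq := modulatedSigma X J ξ
  mono' := modulatedSigma_mono X J ξ
  le' := modulatedSigma_le hX hJ hξ

/-- The σ-algebra generated by the events of probability zero. -/
@[reducible] def nullSigma {Ω : Type*} [MeasurableSpace Ω] (P : Measure Ω) : MeasurableSpace Ω :=
  MeasurableSpace.generateFrom {s | MeasurableSet s ∧ P s = 0}

theorem nullSigma_le {Ω : Type*} [mΩ : MeasurableSpace Ω] (P : Measure Ω) :
    nullSigma P ≤ mΩ :=
  MeasurableSpace.generateFrom_le fun _ hs => hs.1

/-- The right-continuous and complete augmentation of a filtration: all null events are added,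
and then the right-continuation is taken. -/
def usualAugmentation {Ω : Type*} [mΩ : MeasurableSpace Ω] (P : Measure Ω)
    (𝓕 : Filtration unitInterval mΩ) : Filtration unitInterval mΩ :=
  (𝓕 ⊔ Filtration.const unitInterval (nullSigma P) (nullSigma_le P)).rightCont

/-- The last time in `[0,t]` at which source `i` was active,
`0 ∨ sup {u ∈ [0,t] | J_u⁽ⁱⁱ⁾ = 1}`. The supremum is taken in `[0,1]`, where `sSup ∅ = 0`. -/
def lastActive {Ω : Type*} {n : ℕ} (J : unitInterval → Ω → Fin n → ℝ) (i : Fin n)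
    (t : unitInterval) (ω : Ω) : unitInterval :=
  sSup {u | u ≤ t ∧ switchMatrix J u ω i i = 1}

/-- The Gaussian function `h(x, y, t, σ) = exp((x y - t x² / 2) / (σ² (1 - t)))`. -/
def gaussianWeight (x y t σ : ℝ) : ℝ :=
  Real.exp ((x * y - t * x ^ 2 / 2) / (σ ^ 2 * (1 - t)))

/-- The measure `g(x) ν(dx) / ∫ g dν`, for a nonnegative weight `g`. -/
def normalizedWeight {E : Type*} [MeasurableSpace E] (ν : Measure E) (g : E → ℝ) : Measure E :=
  (∫⁻ x, ENNReal.ofReal (g x) ∂ν)⁻¹ • ν.withDensity fun x => ENNReal.ofReal (g x)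

/-- The family of measures `(κ ω)_ω` is a version of the conditional distribution of `X` given
the σ-algebra `m`: almost surely `κ ω` is a probability measure, and `ω ↦ κ ω A` is a version of
`P[X ∈ A | m]` for every measurable set `A`. -/
def IsCondDistribGiven {Ω E : Type*} [mΩ : MeasurableSpace Ω] [MeasurableSpace E] (P : Measure Ω)
    (m : MeasurableSpace Ω) (X : Ω → E) (κ : Ω → Measure E) : Prop :=
  (∀ᵐ ω ∂P, IsProbabilityMeasure (κ ω)) ∧
    ∀ A : Set E, MeasurableSet A →
      P[(X ⁻¹' A).indicator (fun _ => (1 : ℝ)) | m] =ᵐ[P] fun ω => (κ ω).real A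

theorem measurable_infoProcess {Ω : Type*} [MeasurableSpace Ω] {n : ℕ} {P : Measure Ω}
    {X : Ω → ℝ} (hX : Measurable X) (σ : Fin n → ℝ) {β : Fin n → unitInterval → Ω → ℝ}
    (hβ : ∀ i, IsBrownianBridge P (β i)) (i : Fin n) (t : unitInterval) :
    Measurable (infoProcess X σ β i t) :=
  (hX.const_mul _).add (((hβ i).measurable t).const_mul _)

end

end ModulatedInfo

namespace ModulatedInfo

/-! Suppose first that the switching path is deterministic, so that the last active times are
constants `r i < 1`. Given `X = x`, the information path is a family of independent scaled bridges
with drift `u * x`. Stopped at the times `r i`, its law has density `∏ i, h(x, y i, r i, σ i)` with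
respect to the law of the driftless bridges, where `y i` is the value at `r i`. This is a
Cameron–Martin shift: exponential tilting by a jointly Gaussian `L` moves a centred Gaussian process
by its covariance with `L`, and a suitable combination `L` of the terminal values has covariance `u
* x` with coordinate `i` at every `u ≤ r i` (`lintegral_gaussianProcess_tilt`,
`lintegral_bridge_shift`). Integrating over the prior yields Bayes' formula,
`lintegral_indicator_mul_info_eq_posterior`.

A random switching path is independent of the pair (signal, information), so Fubini allows it to be
frozen. The observation depends only on the information path stopped at the last active times.
Conversely, those times and the values there can be recovered measurably from the observation,
almost surely, because switching paths are right-continuous and information paths are continuous.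
This settles the raw filtration.

For the augmented filtration, an event of `𝓕 t` is, up to a null set, an event of the raw σ-algebra
at each `s > t`, so the formula is available at every `s ∈ (t, 1)`. As `s ↓ t` the last active times
converge, and a Scheffé-type argument (all bridge weights have integral one) shows that the positive
part of `π_t B - π_s B` tends to zero in L¹, where `π` denotes the posterior. Hence `∫_G π_t B ≤ P(G
∩ {X ∈ B})`. The same bound for `Bᶜ`, together with `π_t B + π_t Bᶜ = 1`, forces equality. -/

/-! ### Exponential tilting of Gaussian processes -/

theorem isGaussianProcess_prod_of_iIndepFun {Ω ι T : Type*} [MeasurableSpace Ω] {P : Measure Ω}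
    [Fintype ι] {β : ι → T → Ω → ℝ} (hβ : ∀ i, IsGaussianProcess (β i) P)
    (h : iIndepFun (fun i ω t => β i t ω) P) :
    IsGaussianProcess (fun p : ι × T => β p.1 p.2) P where
  hasGaussianLaw I := by
    classical
    -- The index set is enlarged to the rectangle `ι × K`, where independence across the first
    -- factor applies; `Λ` projects back to `I`.
    let K : Finset T := I.image Prod.snd
    have hind : iIndepFun (fun i ω => K.restrict (fun t => β i t ω)) P :=
      h.comp (fun _ f => K.restrict f) fun _ => Finset.measurable_restrict K
    have hg := iIndepFun.hasGaussianLaw (fun i => (hβ i).hasGaussianLaw K) hind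
    let Λ : (ι → K → ℝ) →L[ℝ] I → ℝ :=
      { toFun x p := x p.1.1 ⟨p.1.2, Finset.mem_image_of_mem _ p.2⟩
        map_add' x y := by ext; simp
        map_smul' c x := by ext; simp }
    exact hg.map Λ

/-- Completing the square: the density of N(0, v) times `exp (y - v / 2)` is the density of N(v, v).
-/
theorem lintegral_gaussianReal_tilt {v : NNReal} {g : ℝ → ℝ≥0∞} (hg : Measurable g) :
    ∫⁻ y, g y * ENNReal.ofReal (Real.exp (y - v / 2)) ∂gaussianReal 0 v =
      ∫⁻ y, g (y + v) ∂gaussianReal 0 v := by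
  by_cases hv : v = 0
  · subst hv
    simp
  · rw [← lintegral_map (f := g) hg (by fun_prop), gaussianReal_map_add_const, zero_add,
      gaussianReal_of_var_ne_zero _ hv, gaussianReal_of_var_ne_zero _ hv,
      lintegral_withDensity_eq_lintegral_mul _ (by fun_prop) (by fun_prop),
      lintegral_withDensity_eq_lintegral_mul _ (by fun_prop) (by fun_prop)]
    refine lintegral_congr fun y => ?_
    simp only [Pi.mul_apply, gaussianPDF]
    rw [mul_comm (g y), ← mul_assoc, ← ENNReal.ofReal_mul (gaussianPDFReal_nonneg _ _ _)]
    congr 2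
    simp only [gaussianPDFReal]
    rw [mul_assoc, ← Real.exp_add]
    congr 2
    have : (v : ℝ) ≠ 0 := by exact_mod_cast hv
    field_simp
    ring

/-- Exponential tilting of a centred Gaussian process by a jointly Gaussian variable `L` shifts
the process by its covariance with `L`. -/
theorem lintegral_gaussianProcess_tilt {Ω T : Type*} [MeasurableSpace Ω] {P : Measure Ω}
    {Z : T → Ω → ℝ} {L : Ω → ℝ} (hZ : ∀ t, Measurable (Z t)) (hL : Measurable L)
    (hZL : IsGaussianProcess (Sum.elim Z fun _ : Unit => L) P) (hL0 : ∫ ω, L ω ∂P = 0)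
    {G : (T → ℝ) → ℝ≥0∞} (hG : Measurable G) :
    ∫⁻ ω, G (fun t => Z t ω) * ENNReal.ofReal (Real.exp (L ω - Var[L; P] / 2)) ∂P =
      ∫⁻ ω, G (fun t => Z t ω + cov[Z t, L; P]) ∂P := by
  have := hZL.isProbabilityMeasure
  have hLg : HasGaussianLaw L P := hZL.hasGaussianLaw_eval (Sum.inr ())
  have hZm : ∀ t, MemLp (Z t) 2 P := fun t =>
    (hZL.hasGaussianLaw_eval (Sum.inl t)).memLp_two
  have hLm : MemLp L 2 P := hLg.memLp_two
  set v : NNReal := (Var[L; P]).toNNReal with hv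
  have hvr : (v : ℝ) = Var[L; P] := Real.coe_toNNReal _ (variance_nonneg _ _)
  have hmapL : P.map L = gaussianReal 0 v := by
    rw [hLg.map_eq_gaussianReal, hL0]
  -- If the variance vanishes, then `L = 0` almost surely and both the tilt and the shift are
  -- trivial. The other case divides by the variance.
  by_cases hv0 : Var[L; P] = 0
  · have hL00 : L =ᵐ[P] fun _ => 0 := by
      have h1 := ae_eq_integral_of_variance_eq_zero hLm hv0
      rwa [hL0] at h1
    have hc : ∀ t, cov[Z t, L; P] = 0 := fun t => by
      have h0 : (fun ω => (Z t ω - ∫ x, Z t x ∂P) * (L ω - ∫ x, L x ∂P)) =ᵐ[P] fun _ => 0 := by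
        filter_upwards [hL00] with ω hω
        simp [hω, hL0]
      rw [covariance, integral_congr_ae h0, integral_zero]
    refine lintegral_congr_ae ?_
    filter_upwards [hL00] with ω hω
    simp [hω, hv0, hc]
  -- Regression coefficient of `Z t` on `L`: the residual `R` is uncorrelated with `L`, hence
  -- independent of it by joint Gaussianity. The tilt then acts on `L` alone, shifting it by `v`,
  -- and `a t * v` is the required covariance.
  · let a : T → ℝ := fun t => cov[Z t, L; P] / Var[L; P]
    let R : T → Ω → ℝ := fun t ω => Z t ω - a t * L ω
    have hR : ∀ t, Measurable (R t) := fun t => (hZ t).sub (hL.const_mul _)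
    have hRL : IsGaussianProcess (Sum.elim R fun _ : Unit => L) P := by
      classical
      refine hZL.of_isGaussianProcess fun s => ?_
      rcases s with t | u
      · refine ⟨{Sum.inl t, Sum.inr ()},
          { toFun x := x ⟨Sum.inl t, by simp⟩ - a t * x ⟨Sum.inr (), by simp⟩
            map_add' x y := by simp; ring
            map_smul' c x := by simp; ring }, fun ω => ?_⟩
        simp [R]
      · refine ⟨{Sum.inr ()},
          { toFun x := x ⟨Sum.inr (), by simp⟩
            map_add' x y := by simp
            map_smul' c x := by simp }, fun ω => ?_⟩
        simp
    have hind : IndepFun (fun ω t => R t ω) (fun ω (_ : Unit) => L ω) P := by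
      refine hRL.indepFun_of_covariance_eq_zero (fun t => (hR t).aemeasurable)
        (fun _ => hL.aemeasurable) fun t _ => ?_
      change cov[Z t - fun ω => a t * L ω, L; P] = 0
      rw [covariance_sub_left (hZm t) (hLm.const_mul _) hLm, covariance_const_mul_left,
        covariance_self hL.aemeasurable]
      simp only [a]
      field_simp
      simp
    have hind' : IndepFun (fun ω t => R t ω) L P :=
      hind.comp (φ := id) (ψ := fun f : Unit → ℝ => f ()) measurable_id (measurable_pi_apply _)
    have hRm : Measurable fun ω t => R t ω := measurable_pi_iff.2 hR
    have hprod := (indepFun_iff_map_prod_eq_prod_map_map hRm.aemeasurable hL.aemeasurable).1 hind'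
    have hprob : IsProbabilityMeasure (P.map fun ω t => R t ω) :=
      Measure.isProbabilityMeasure_map hRm.aemeasurable
    have key : ∀ F : (T → ℝ) × ℝ → ℝ≥0∞, Measurable F →
        ∫⁻ ω, F (fun t => R t ω, L ω) ∂P =
          ∫⁻ ρ, ∫⁻ y, F (ρ, y) ∂gaussianReal 0 v ∂(P.map fun ω t => R t ω) := by
      intro F hF
      rw [← lintegral_map (f := F) hF (hRm.prodMk hL), hprod, lintegral_prod _ hF.aemeasurable,
        hmapL]
    have hG1 : Measurable fun q : (T → ℝ) × ℝ => G (fun t => q.1 t + a t * q.2) := by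
      refine hG.comp (measurable_pi_iff.2 fun t => ?_)
      exact ((measurable_pi_apply t).comp measurable_fst).add (measurable_snd.const_mul _)
    have hG2 : Measurable fun q : (T → ℝ) × ℝ => G (fun t => q.1 t + a t * (q.2 + v)) := by
      refine hG.comp (measurable_pi_iff.2 fun t => ?_)
      exact ((measurable_pi_apply t).comp measurable_fst).add
        ((measurable_snd.add_const _).const_mul _)
    have e1 := key (fun q => G (fun t => q.1 t + a t * q.2) *
      ENNReal.ofReal (Real.exp (q.2 - v / 2))) (hG1.mul (by fun_prop))
    have e2 := key _ hG2
    have hav : ∀ t, a t * v = cov[Z t, L; P] := fun t => by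
      simp only [a, hvr]
      field_simp
    simp only [R, sub_add_cancel] at e1
    simp only [R, mul_add, hav, ← add_assoc, sub_add_cancel] at e2
    rw [← hvr, e1, e2]
    refine lintegral_congr fun ρ => ?_
    rw [lintegral_gaussianReal_tilt (g := fun y => G (fun t => ρ t + a t * y))
      (hG1.comp measurable_prodMk_left)]
    simp only [mul_add, hav, ← add_assoc]

/-- The path `p` with coordinate `i` stopped at time `r i`. -/
def stopAt {n : ℕ} (r : Fin n → unitInterval) (p : Fin n → unitInterval → ℝ) :
    Fin n → unitInterval → ℝ :=
  fun i u => p i (min u (r i))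

/-- The product of the Gaussian weights of the coordinates, as an extended nonnegative number. -/
@[irreducible] noncomputable def bayesWeight {n : ℕ} (σ : Fin n → ℝ) (r : Fin n → unitInterval) (y : Fin n → ℝ)
    (x : ℝ) : ℝ≥0∞ :=
  ENNReal.ofReal (∏ i, gaussianWeight x (y i) (r i) (σ i))

/-! ### Change of measure for Brownian bridges -/

section Bridge

variable {Ω : Type*} [MeasurableSpace Ω] {P : Measure Ω} {n : ℕ} {σ : Fin n → ℝ}
  {β : Fin n → unitInterval → Ω → ℝ}

theorem IsBrownianBridge.memLp {β : unitInterval → Ω → ℝ} (hβ : IsBrownianBridge P β)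
    (t : unitInterval) : MemLp (β t) 2 P :=
  (hβ.gaussian.hasGaussianLaw_eval t).memLp_two

theorem IsBrownianBridge.ae_eq_zero {β : unitInterval → Ω → ℝ} (hβ : IsBrownianBridge P β)
    {t : unitInterval} (ht : (t : ℝ) = 0 ∨ (t : ℝ) = 1) : β t =ᵐ[P] fun _ => 0 := by
  have := hβ.gaussian.isProbabilityMeasure
  have hv : Var[β t; P] = 0 := by
    rw [← covariance_self (hβ.measurable t).aemeasurable, hβ.covariance]
    rcases ht with h | h <;> simp [h]
  have h1 := ae_eq_integral_of_variance_eq_zero (hβ.memLp t) hv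
  rwa [hβ.mean] at h1

/-- A Girsanov formula for independent bridges with drift `t x`, stopped at the times `r i`. -/
theorem lintegral_bridge_shift (hσ : ∀ i, 0 < σ i) (hβ : ∀ i, IsBrownianBridge P (β i))
    (hββ : iIndepFun (fun i ω t => β i t ω) P) {r : Fin n → unitInterval} (hr : ∀ i, r i < 1)
    (x : ℝ) {G : (Fin n → unitInterval → ℝ) → ℝ≥0∞} (hG : Measurable G)
    (hGr : ∀ p, G (stopAt r p) = G p) :
    ∫⁻ ω, G (fun i u => u * x + σ i * β i u ω) ∂P =
      ∫⁻ ω, G (fun i u => σ i * β i u ω) *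
        bayesWeight σ r (fun i => σ i * β i (r i) ω) x ∂P := by
  have hprob := hββ.isProbabilityMeasure
  have hr1 : ∀ i, (1 : ℝ) - r i ≠ 0 := fun i => by
    have : ((r i : unitInterval) : ℝ) < 1 := hr i
    linarith
  -- For `u ≤ r i` the bridge covariance is `u * (1 - r i)`, so this `c i` makes the covariance of
  -- `σ i * β i u` with `L` equal to `u * x`.
  let c : Fin n → ℝ := fun i => x / (σ i ^ 2 * (1 - r i))
  let Z : Fin n × unitInterval → Ω → ℝ := fun p ω => σ p.1 * β p.1 (min p.2 (r p.1)) ω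
  let L : Ω → ℝ := fun ω => ∑ i, c i * (σ i * β i (r i) ω)
  have hgauss := isGaussianProcess_prod_of_iIndepFun (fun i => (hβ i).gaussian) hββ
  have hZ : ∀ p, Measurable (Z p) := fun p => ((hβ p.1).measurable _).const_mul _
  have hL : Measurable L :=
    Finset.measurable_sum _ fun i _ => (((hβ i).measurable _).const_mul _).const_mul _
  have hZL : IsGaussianProcess (Sum.elim Z fun _ : Unit => L) P := by
    classical
    refine hgauss.of_isGaussianProcess fun s => ?_
    rcases s with p | u
    · refine ⟨{(p.1, min p.2 (r p.1))},
        { toFun x := σ p.1 * x ⟨(p.1, min p.2 (r p.1)), by simp⟩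
          map_add' x y := by simp; ring
          map_smul' c x := by simp; ring }, fun ω => ?_⟩
      simp [Z]
    · refine ⟨Finset.univ.image fun i => (i, r i),
        { toFun x := ∑ i, c i * (σ i * x ⟨(i, r i), by simp⟩)
          map_add' x y := by simp [mul_add, Finset.sum_add_distrib]
          map_smul' d x := by
            simp only [Pi.smul_apply, smul_eq_mul, RingHom.id_apply, Finset.mul_sum]
            exact Finset.sum_congr rfl fun i _ => by ring }, fun ω => ?_⟩
      simp [L]
  have hL0 : ∫ ω, L ω ∂P = 0 := by
    simp only [L]
    rw [integral_finsetSum]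
    · simp [integral_const_mul, (hβ _).mean]
    · exact fun i _ => ((((hβ i).memLp _).integrable one_le_two).const_mul _).const_mul _
  have hcov : ∀ i u, cov[fun ω => σ i * β i (min u (r i)) ω, L; P] =
      ((min u (r i) : unitInterval) : ℝ) * x := by
    intro i u
    have hmem : ∀ j, MemLp (fun ω => c j * (σ j * β j (r j) ω)) 2 P := fun j =>
      (((hβ j).memLp _).const_mul _).const_mul _
    have hs : L = ∑ j, fun ω => c j * (σ j * β j (r j) ω) := by
      ext ω
      simp [L]
    rw [hs, covariance_sum_right hmem (((hβ i).memLp _).const_mul _), Finset.sum_eq_single i]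
    · rw [covariance_const_mul_right, covariance_const_mul_right, covariance_const_mul_left,
        (hβ i).covariance]
      have h1 := hr1 i
      have h2 := (hσ i).ne'
      have h3 : min ((min u (r i) : unitInterval) : ℝ) (r i : ℝ) =
          ((min u (r i) : unitInterval) : ℝ) :=
        min_eq_left (by exact_mod_cast min_le_right u (r i))
      rw [h3]
      simp only [c]
      field_simp
    · intro j _ hj
      rw [covariance_const_mul_right, covariance_const_mul_right, covariance_const_mul_left]
      have hi : IndepFun (β i (min u (r i))) (β j (r j)) P :=
        (hββ.indepFun hj.symm).comp (φ := fun f : unitInterval → ℝ => f (min u (r i)))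
          (ψ := fun f : unitInterval → ℝ => f (r j)) (measurable_pi_apply _)
          (measurable_pi_apply _)
      rw [hi.covariance_eq_zero ((hβ i).memLp _) ((hβ j).memLp _)]
      simp
    · simp
  have hvar : Var[L; P] = ∑ i, c i * (r i * x) := by
    have hmem : ∀ j, MemLp (fun ω => c j * (σ j * β j (r j) ω)) 2 P := fun j =>
      (((hβ j).memLp _).const_mul _).const_mul _
    have hLm : MemLp L 2 P := memLp_finsetSum _ fun j _ => hmem j
    have hs : L = ∑ j, fun ω => c j * (σ j * β j (r j) ω) := by
      ext ω
      simp [L]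
    rw [← covariance_self hL.aemeasurable]
    conv_lhs => enter [1]; rw [hs]
    rw [covariance_sum_left hmem hLm]
    refine Finset.sum_congr rfl fun i _ => ?_
    have := hcov i (r i)
    rw [min_self] at this
    rw [covariance_const_mul_left, this]
  have hcurry : Measurable fun q : Fin n × unitInterval → ℝ => G fun i u => q (i, u) :=
    hG.comp (measurable_pi_iff.2 fun i => measurable_pi_iff.2 fun u => measurable_pi_apply _)
  have key := lintegral_gaussianProcess_tilt hZ hL hZL hL0 hcurry
  calc ∫⁻ ω, G (fun i u => u * x + σ i * β i u ω) ∂P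
      = ∫⁻ ω, G (fun i u => Z (i, u) ω + cov[Z (i, u), L; P]) ∂P := by
        refine lintegral_congr fun ω => ?_
        rw [← hGr]
        congr 1
        ext i u
        simp only [Z, hcov, stopAt]
        ring
    _ = _ := key.symm
    _ = _ := by
        refine lintegral_congr fun ω => ?_
        congr 1
        · rw [← hGr fun i u => σ i * β i u ω]
          rfl
        · rw [bayesWeight]
          simp only [gaussianWeight]
          rw [← Real.exp_sum, hvar, Finset.sum_div, ← Finset.sum_sub_distrib]
          congr 2
          refine Finset.sum_congr rfl fun i _ => ?_
          have h1 := hr1 i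
          have h2 := (hσ i).ne'
          simp only [c]
          field_simp

end Bridge

/-- The unnormalised posterior mass of `B`, for the prior `ν`. -/
@[irreducible] noncomputable def posteriorMass {n : ℕ} (ν : Measure ℝ) (σ : Fin n → ℝ) (r : Fin n → unitInterval)
    (y : Fin n → ℝ) (B : Set ℝ) : ℝ≥0∞ :=
  ∫⁻ x in B, bayesWeight σ r y x ∂ν

/-- The posterior probability of `B`, for the prior `ν`. -/
@[irreducible] noncomputable def posterior {n : ℕ} (ν : Measure ℝ) (σ : Fin n → ℝ) (r : Fin n → unitInterval)
    (y : Fin n → ℝ) (B : Set ℝ) : ℝ≥0∞ :=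
  posteriorMass ν σ r y B / posteriorMass ν σ r y Set.univ

/-! ### Measurability and continuity of the Bayes weights -/

section Weight

variable {n : ℕ} {ν : Measure ℝ} {σ : Fin n → ℝ}

theorem measurable_bayesWeight (σ : Fin n → ℝ) :
    Measurable fun q : ((Fin n → unitInterval) × (Fin n → ℝ)) × ℝ =>
      bayesWeight σ q.1.1 q.1.2 q.2 := by
  simp only [bayesWeight, gaussianWeight]
  refine ENNReal.measurable_ofReal.comp (Finset.measurable_prod _ fun i _ => ?_)
  refine Real.measurable_exp.comp ?_
  have h1 : Measurable fun q : ((Fin n → unitInterval) × (Fin n → ℝ)) × ℝ => ((q.1.1 i : ℝ)) :=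
    measurable_subtype_coe.comp ((measurable_pi_apply i).comp (measurable_fst.comp measurable_fst))
  have h2 : Measurable fun q : ((Fin n → unitInterval) × (Fin n → ℝ)) × ℝ => q.1.2 i :=
    (measurable_pi_apply i).comp (measurable_snd.comp measurable_fst)
  have h3 : Measurable fun q : ((Fin n → unitInterval) × (Fin n → ℝ)) × ℝ => q.2 := measurable_snd
  exact ((h3.mul h2).sub ((h1.mul (h3.pow_const 2)).div_const 2)).div
    ((measurable_const.sub h1).const_mul _)

theorem measurable_posteriorMass [SFinite ν] (σ : Fin n → ℝ) (B : Set ℝ) :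
    Measurable fun q : (Fin n → unitInterval) × (Fin n → ℝ) => posteriorMass ν σ q.1 q.2 B := by
  simp only [posteriorMass]
  exact (measurable_bayesWeight σ).lintegral_prod_right'

theorem measurable_posterior [SFinite ν] (σ : Fin n → ℝ) (B : Set ℝ) :
    Measurable fun q : (Fin n → unitInterval) × (Fin n → ℝ) => posterior ν σ q.1 q.2 B := by
  simp only [posterior]
  exact (measurable_posteriorMass σ B).div (measurable_posteriorMass σ Set.univ)

theorem bayesWeight_pos (r : Fin n → unitInterval) (y : Fin n → ℝ) (x : ℝ) :
    0 < bayesWeight σ r y x := by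
  rw [bayesWeight]
  exact ENNReal.ofReal_pos.2 (Finset.prod_pos fun _ _ => Real.exp_pos _)

theorem posteriorMass_univ_ne_zero [IsProbabilityMeasure ν] (r : Fin n → unitInterval)
    (y : Fin n → ℝ) : posteriorMass ν σ r y Set.univ ≠ 0 := by
  have hm : Measurable fun x => bayesWeight σ r y x :=
    (measurable_bayesWeight σ).comp (measurable_prodMk_left (x := (r, y)))
  rw [posteriorMass, Measure.restrict_univ, Ne, lintegral_eq_zero_iff hm]
  intro h
  obtain ⟨x, hx⟩ := h.exists
  exact (bayesWeight_pos r y x).ne' hx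

theorem posteriorMass_mono (r : Fin n → unitInterval) (y : Fin n → ℝ) (B : Set ℝ) :
    posteriorMass ν σ r y B ≤ posteriorMass ν σ r y Set.univ := by
  simp only [posteriorMass]
  exact lintegral_mono_set (Set.subset_univ B)

theorem posterior_le_one (r : Fin n → unitInterval) (y : Fin n → ℝ) (B : Set ℝ) :
    posterior ν σ r y B ≤ 1 := by
  rw [posterior]
  exact ENNReal.div_le_of_le_mul (by rw [one_mul]; exact posteriorMass_mono r y B)

theorem posterior_add_compl [IsProbabilityMeasure ν] {r : Fin n → unitInterval} {y : Fin n → ℝ}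
    {B : Set ℝ} (hB : MeasurableSet B) (h : posteriorMass ν σ r y Set.univ ≠ ∞) :
    posterior ν σ r y B + posterior ν σ r y Bᶜ = 1 := by
  rw [posterior, posterior, ENNReal.div_add_div_same]
  have : posteriorMass ν σ r y B + posteriorMass ν σ r y Bᶜ = posteriorMass ν σ r y Set.univ := by
    simp only [posteriorMass, Measure.restrict_univ]
    exact lintegral_add_compl _ hB
  rw [this, ENNReal.div_self (posteriorMass_univ_ne_zero r y) h]

theorem tendsto_bayesWeight (hσ : ∀ i, 0 < σ i) {r : Fin n → unitInterval} (hr : ∀ i, r i < 1)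
    {rk : ℕ → Fin n → unitInterval} (hrk : Tendsto rk atTop (𝓝 r)) {y : Fin n → ℝ}
    {yk : ℕ → Fin n → ℝ} (hyk : Tendsto yk atTop (𝓝 y)) (x : ℝ) :
    Tendsto (fun k => bayesWeight σ (rk k) (yk k) x) atTop (𝓝 (bayesWeight σ r y x)) := by
  simp only [bayesWeight]
  refine ENNReal.tendsto_ofReal (tendsto_finsetProd _ fun i _ => ?_)
  have h1 : Tendsto (fun k => ((rk k i : unitInterval) : ℝ)) atTop (𝓝 (r i : ℝ)) :=
    (continuous_subtype_val.tendsto _).comp ((tendsto_pi_nhds.1 hrk) i)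
  have h2 := (tendsto_pi_nhds.1 hyk) i
  have h3 : ((r i : unitInterval) : ℝ) < 1 := hr i
  refine (Real.continuous_exp.tendsto _).comp (Tendsto.div ?_ ?_ ?_)
  · exact (h2.const_mul x).sub ((h1.mul_const _).div_const _)
  · exact (tendsto_const_nhds.sub h1).const_mul _
  · exact mul_ne_zero (pow_ne_zero _ (hσ i).ne') (by linarith)

end Weight

/-! ### Bayes' formula at deterministic observation times -/

section Bayes

variable {Ω : Type*} [MeasurableSpace Ω] {P : Measure Ω} {n : ℕ} {σ : Fin n → ℝ}
  {β : Fin n → unitInterval → Ω → ℝ} {X : Ω → ℝ} {r : Fin n → unitInterval}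

theorem measurable_bridgePath (hβ : ∀ i, IsBrownianBridge P (β i)) (σ : Fin n → ℝ) :
    Measurable fun ω i u => σ i * β i u ω :=
  measurable_pi_iff.2 fun i => measurable_pi_iff.2 fun u => ((hβ i).measurable u).const_mul _

theorem measurable_infoPath (hX : Measurable X) (hβ : ∀ i, IsBrownianBridge P (β i))
    (σ : Fin n → ℝ) : Measurable fun ω i u => infoProcess X σ β i u ω :=
  measurable_pi_iff.2 fun i => measurable_pi_iff.2 fun u => measurable_infoProcess hX σ hβ i u

theorem measurable_evalAt (r : Fin n → unitInterval) :
    Measurable fun (p : Fin n → unitInterval → ℝ) i => p i (r i) :=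
  measurable_pi_iff.2 fun i => (measurable_pi_apply (r i)).comp (measurable_pi_apply i)

theorem measurable_posteriorMass_evalAt {ν : Measure ℝ} [SFinite ν] (σ : Fin n → ℝ)
    (r : Fin n → unitInterval) (B : Set ℝ) :
    Measurable fun p : Fin n → unitInterval → ℝ => posteriorMass ν σ r (fun i => p i (r i)) B :=
  (measurable_posteriorMass σ B).comp
    (measurable_const.prodMk (measurable_evalAt r) :
      Measurable fun p : Fin n → unitInterval → ℝ => (r, fun i => p i (r i)))

theorem measurable_posterior_evalAt {ν : Measure ℝ} [SFinite ν] (σ : Fin n → ℝ)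
    (r : Fin n → unitInterval) (B : Set ℝ) :
    Measurable fun p : Fin n → unitInterval → ℝ => posterior ν σ r (fun i => p i (r i)) B :=
  (measurable_posterior σ B).comp
    (measurable_const.prodMk (measurable_evalAt r) :
      Measurable fun p : Fin n → unitInterval → ℝ => (r, fun i => p i (r i)))

theorem measurable_bayesWeight_bridge (hβ : ∀ i, IsBrownianBridge P (β i)) (σ : Fin n → ℝ)
    (r : Fin n → unitInterval) :
    Measurable fun q : ℝ × Ω => bayesWeight σ r (fun i => σ i * β i (r i) q.2) q.1 := by
  have h : Measurable fun q : ℝ × Ω => ((r, fun i => σ i * β i (r i) q.2), q.1) := by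
    refine Measurable.prodMk (measurable_const.prodMk ?_) measurable_fst
    exact measurable_pi_iff.2 fun i => (((hβ i).measurable _).comp measurable_snd).const_mul _
  exact (measurable_bayesWeight σ).comp h

/-- Bayes' formula: change from the law of the information process to that of the bridges. -/
theorem lintegral_indicator_mul_info (hX : Measurable X) (hσ : ∀ i, 0 < σ i)
    (hβ : ∀ i, IsBrownianBridge P (β i)) (hββ : iIndepFun (fun i ω t => β i t ω) P)
    (hXβ : IndepFun X (fun ω i t => β i t ω) P) (hr : ∀ i, r i < 1) {B : Set ℝ}
    (hB : MeasurableSet B) {G : (Fin n → unitInterval → ℝ) → ℝ≥0∞} (hG : Measurable G)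
    (hGr : ∀ p, G (stopAt r p) = G p) :
    ∫⁻ ω, B.indicator 1 (X ω) * G (fun i u => infoProcess X σ β i u ω) ∂P =
      ∫⁻ ω, G (fun i u => σ i * β i u ω) *
        posteriorMass (P.map X) σ r (fun i => σ i * β i (r i) ω) B ∂P := by
  have hprob := hββ.isProbabilityMeasure
  have hβm : Measurable fun ω i t => β i t ω :=
    measurable_pi_iff.2 fun i => measurable_pi_iff.2 fun u => (hβ i).measurable u
  have hprobX : IsProbabilityMeasure (P.map X) := Measure.isProbabilityMeasure_map hX.aemeasurable
  have hprobβ : IsProbabilityMeasure (P.map fun ω i t => β i t ω) :=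
    Measure.isProbabilityMeasure_map hβm.aemeasurable
  have hprod := (indepFun_iff_map_prod_eq_prod_map_map hX.aemeasurable hβm.aemeasurable).1 hXβ
  have hB1 : Measurable (B.indicator (1 : ℝ → ℝ≥0∞)) := measurable_one.indicator hB
  let F : ℝ × (Fin n → unitInterval → ℝ) → ℝ≥0∞ := fun q =>
    B.indicator 1 q.1 * G (fun i u => u * q.1 + σ i * q.2 i u)
  have hF : Measurable F := by
    refine (hB1.comp measurable_fst).mul (hG.comp ?_)
    refine measurable_pi_iff.2 fun i => measurable_pi_iff.2 fun u => ?_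
    have h : Measurable fun q : ℝ × (Fin n → unitInterval → ℝ) => q.2 i u :=
      (measurable_pi_apply u).comp ((measurable_pi_apply i).comp measurable_snd)
    exact (measurable_fst.const_mul _).add (h.const_mul _)
  have hw := measurable_bayesWeight_bridge hβ σ r
  have hGb : Measurable fun ω => G fun i u => σ i * β i u ω :=
    hG.comp (measurable_bridgePath hβ σ)
  calc ∫⁻ ω, B.indicator 1 (X ω) * G (fun i u => infoProcess X σ β i u ω) ∂P
      = ∫⁻ x, ∫⁻ ω, F (x, fun i u => β i u ω) ∂P ∂P.map X := by
        have h1 := lintegral_map hF (hX.prodMk hβm) (μ := P)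
        rw [hprod, lintegral_prod _ hF.aemeasurable] at h1
        refine h1.symm.trans (lintegral_congr fun x => ?_)
        exact lintegral_map (f := fun q => F (x, q)) (hF.comp measurable_prodMk_left) hβm
    _ = ∫⁻ x in B, ∫⁻ ω, G (fun i u => σ i * β i u ω) *
          bayesWeight σ r (fun i => σ i * β i (r i) ω) x ∂P ∂P.map X := by
        rw [← lintegral_indicator hB]
        refine lintegral_congr fun x => ?_
        by_cases hx : x ∈ B
        · simp only [F, Set.indicator_of_mem hx, Pi.one_apply, one_mul]
          exact lintegral_bridge_shift hσ hβ hββ hr x hG hGr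
        · simp [F, hx]
    _ = ∫⁻ ω, ∫⁻ x in B, G (fun i u => σ i * β i u ω) *
          bayesWeight σ r (fun i => σ i * β i (r i) ω) x ∂P.map X ∂P :=
        lintegral_lintegral_swap ((hGb.comp measurable_snd).mul hw).aemeasurable
    _ = _ := by
        refine lintegral_congr fun ω => ?_
        have hx : Measurable fun x => bayesWeight σ r (fun i => σ i * β i (r i) ω) x :=
          hw.comp measurable_prodMk_right
        rw [lintegral_const_mul _ hx, posteriorMass]

/-- The total posterior mass is the density of the law of the stopped information path with respect
to that of the stopped bridges. -/
theorem lintegral_info (hX : Measurable X) (hσ : ∀ i, 0 < σ i)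
    (hβ : ∀ i, IsBrownianBridge P (β i)) (hββ : iIndepFun (fun i ω t => β i t ω) P)
    (hXβ : IndepFun X (fun ω i t => β i t ω) P) (hr : ∀ i, r i < 1)
    {G : (Fin n → unitInterval → ℝ) → ℝ≥0∞} (hG : Measurable G)
    (hGr : ∀ p, G (stopAt r p) = G p) :
    ∫⁻ ω, G (fun i u => infoProcess X σ β i u ω) ∂P =
      ∫⁻ ω, G (fun i u => σ i * β i u ω) *
        posteriorMass (P.map X) σ r (fun i => σ i * β i (r i) ω) Set.univ ∂P := by
  simpa using lintegral_indicator_mul_info hX hσ hβ hββ hXβ hr MeasurableSet.univ hG hGr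

/-- As a density, the total mass has integral one, hence is almost surely finite. -/
theorem posteriorMass_bridge_ne_top (hX : Measurable X) (hσ : ∀ i, 0 < σ i)
    (hβ : ∀ i, IsBrownianBridge P (β i)) (hββ : iIndepFun (fun i ω t => β i t ω) P)
    (hXβ : IndepFun X (fun ω i t => β i t ω) P) (hr : ∀ i, r i < 1) :
    ∀ᵐ ω ∂P, posteriorMass (P.map X) σ r (fun i => σ i * β i (r i) ω) Set.univ ≠ ∞ := by
  have hprob := hββ.isProbabilityMeasure
  have h := lintegral_info hX hσ hβ hββ hXβ hr (G := fun _ => 1) measurable_const fun _ => rfl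
  simp only [lintegral_one, measure_univ, one_mul] at h
  refine (ae_lt_top ?_ (by rw [← h]; exact ENNReal.one_ne_top)).mono fun _ => ne_of_lt
  exact (measurable_posteriorMass_evalAt σ r Set.univ).comp (measurable_bridgePath hβ σ)

/-- Finiteness transfers from the bridges to the information path by absolute continuity. -/
theorem posteriorMass_info_ne_top (hX : Measurable X) (hσ : ∀ i, 0 < σ i)
    (hβ : ∀ i, IsBrownianBridge P (β i)) (hββ : iIndepFun (fun i ω t => β i t ω) P)
    (hXβ : IndepFun X (fun ω i t => β i t ω) P) (hr : ∀ i, r i < 1) :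
    ∀ᵐ ω ∂P, posteriorMass (P.map X) σ r (fun i => infoProcess X σ β i (r i) ω) Set.univ ≠ ∞ := by
  have hprob := hββ.isProbabilityMeasure
  let S : Set (Fin n → unitInterval → ℝ) :=
    {p | posteriorMass (P.map X) σ r (fun i => p i (r i)) Set.univ = ∞}
  have hS : MeasurableSet S :=
    measurable_posteriorMass_evalAt σ r Set.univ (measurableSet_singleton ∞)
  have hm : Measurable (S.indicator (1 : (Fin n → unitInterval → ℝ) → ℝ≥0∞)) := measurable_one.indicator hS
  have h := lintegral_info hX hσ hβ hββ hXβ hr hm fun p => by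
    simp [S, Set.indicator, stopAt]
  have h0 : ∫⁻ ω, S.indicator 1 (fun i u => σ i * β i u ω) *
      posteriorMass (P.map X) σ r (fun i => σ i * β i (r i) ω) Set.univ ∂P = 0 := by
    refine lintegral_eq_zero_of_ae_eq_zero ?_
    filter_upwards [posteriorMass_bridge_ne_top hX hσ hβ hββ hXβ hr] with ω hω
    simp [S, hω]
  have hm' : Measurable fun ω => S.indicator (1 : (Fin n → unitInterval → ℝ) → ℝ≥0∞)
      fun i u => infoProcess X σ β i u ω := hm.comp (measurable_infoPath hX hβ σ)
  rw [h0, lintegral_eq_zero_iff hm'] at h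
  filter_upwards [h] with ω hω
  simpa [S, Set.indicator] using hω

/-- The posterior is the conditional distribution of the signal given the information processes
up to deterministic times. -/
theorem lintegral_indicator_mul_info_eq_posterior (hX : Measurable X) (hσ : ∀ i, 0 < σ i)
    (hβ : ∀ i, IsBrownianBridge P (β i)) (hββ : iIndepFun (fun i ω t => β i t ω) P)
    (hXβ : IndepFun X (fun ω i t => β i t ω) P) (hr : ∀ i, r i < 1) {B : Set ℝ}
    (hB : MeasurableSet B) {G : (Fin n → unitInterval → ℝ) → ℝ≥0∞} (hG : Measurable G)
    (hGr : ∀ p, G (stopAt r p) = G p) :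
    ∫⁻ ω, B.indicator 1 (X ω) * G (fun i u => infoProcess X σ β i u ω) ∂P =
      ∫⁻ ω, posterior (P.map X) σ r (fun i => infoProcess X σ β i (r i) ω) B *
        G (fun i u => infoProcess X σ β i u ω) ∂P := by
  have hprob := hββ.isProbabilityMeasure
  have hprobX : IsProbabilityMeasure (P.map X) := Measure.isProbabilityMeasure_map hX.aemeasurable
  rw [lintegral_indicator_mul_info hX hσ hβ hββ hXβ hr hB hG hGr]
  have hm : Measurable fun p : Fin n → unitInterval → ℝ =>
      posterior (P.map X) σ r (fun i => p i (r i)) B * G p :=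
    (measurable_posterior_evalAt σ r B).mul hG
  rw [lintegral_info hX hσ hβ hββ hXβ hr hm fun p => by rw [hGr]; simp [stopAt]]
  refine lintegral_congr_ae ?_
  filter_upwards [posteriorMass_bridge_ne_top hX hσ hβ hββ hXβ hr] with ω hω
  -- The denominator of the posterior is exactly the density from `lintegral_info`, so it cancels.
  rw [mul_right_comm, posterior, ENNReal.div_mul_cancel (posteriorMass_univ_ne_zero _ _) hω,
    mul_comm]

end Bayes

/-! ### L¹ continuity of the posterior in the observation times -/

/-- Subtraction is truncated, so the difference is dominated by `f` and no bound on the `fk` is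
needed: the one-sided half of Scheffé's lemma. -/
theorem tendsto_lintegral_sub_of_tendsto_ae {α : Type*} [MeasurableSpace α] {μ : Measure α}
    {f : α → ℝ≥0∞} {fk : ℕ → α → ℝ≥0∞} (hf : Measurable f) (hfk : ∀ k, Measurable (fk k))
    (hfin : ∫⁻ a, f a ∂μ ≠ ∞) (hlim : ∀ᵐ a ∂μ, Tendsto (fun k => fk k a) atTop (𝓝 (f a))) :
    Tendsto (fun k => ∫⁻ a, (f a - fk k a) ∂μ) atTop (𝓝 0) := by
  have h := tendsto_lintegral_of_dominated_convergence (μ := μ) (F := fun k a => f a - fk k a)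
    (f := fun _ => 0) f (fun k => hf.sub (hfk k)) (fun k => ae_of_all _ fun a => tsub_le_self) hfin
    (by
      filter_upwards [hlim, ae_lt_top hf hfin] with a ha hfa
      have h1 := ENNReal.Tendsto.sub (tendsto_const_nhds (x := f a)) ha (Or.inl hfa.ne)
      simpa using h1)
  simpa using h

/-- Both `f + (g - f)` and `g + (f - g)` equal the maximum. This supplies the other half of
Scheffé's lemma. -/
theorem lintegral_sub_comm_of_lintegral_eq {α : Type*} [MeasurableSpace α] {μ : Measure α}
    {f g : α → ℝ≥0∞} (hf : Measurable f) (hg : Measurable g)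
    (hfin : ∫⁻ a, f a ∂μ ≠ ∞) (hfg : ∫⁻ a, f a ∂μ = ∫⁻ a, g a ∂μ) :
    ∫⁻ a, (f a - g a) ∂μ = ∫⁻ a, (g a - f a) ∂μ := by
  have h : ∫⁻ a, f a ∂μ + ∫⁻ a, (g a - f a) ∂μ = ∫⁻ a, g a ∂μ + ∫⁻ a, (f a - g a) ∂μ := by
    rw [← lintegral_add_left hf, ← lintegral_add_left hg]
    refine lintegral_congr fun a => ?_
    rw [add_tsub_eq_max, add_tsub_eq_max, max_comm]
  rw [← hfg] at h
  exact ((ENNReal.add_right_inj hfin).1 h).symm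

section Continuity

variable {Ω : Type*} [MeasurableSpace Ω] {P : Measure Ω} {n : ℕ} {σ : Fin n → ℝ}
  {β : Fin n → unitInterval → Ω → ℝ} {X : Ω → ℝ} {r : Fin n → unitInterval}

theorem lintegral_bayesWeight_bridge (hσ : ∀ i, 0 < σ i)
    (hβ : ∀ i, IsBrownianBridge P (β i)) (hββ : iIndepFun (fun i ω t => β i t ω) P)
    (hr : ∀ i, r i < 1) (x : ℝ) :
    ∫⁻ ω, bayesWeight σ r (fun i => σ i * β i (r i) ω) x ∂P = 1 := by
  have hprob := hββ.isProbabilityMeasure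
  have h := lintegral_bridge_shift hσ hβ hββ hr x (G := fun _ => 1) measurable_const fun _ => rfl
  simpa using h.symm

/-- Used with `a / b` and `c / d` the posteriors at two observation times and `d` the density at the
later one: the weighted decrease of the posterior is controlled by differences of unnormalised
masses. -/
theorem div_sub_div_mul_le {a b c d : ℝ≥0∞} (hab : a ≤ b) (hb0 : b ≠ 0) (hb : b ≠ ∞)
    (hd0 : d ≠ 0) (hd : d ≠ ∞) : (a / b - c / d) * d ≤ (a - c) + (d - b) := by
  rw [ENNReal.sub_mul fun _ _ => hd, ENNReal.div_mul_cancel hd0 hd]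
  have h1 : a / b * d ≤ a + (d - b) := by
    calc a / b * d ≤ a / b * (b + (d - b)) := by gcongr; exact le_add_tsub
      _ = a + a / b * (d - b) := by rw [mul_add, ENNReal.div_mul_cancel hb0 hb]
      _ ≤ a + 1 * (d - b) := by
        gcongr
        exact ENNReal.div_le_of_le_mul (by rwa [one_mul])
      _ = a + (d - b) := by rw [one_mul]
  calc a / b * d - c ≤ a + (d - b) - c := tsub_le_tsub_right h1 c
    _ ≤ (a - c) + (d - b) := add_tsub_le_tsub_add

theorem tendsto_lintegral_posterior_sub (hX : Measurable X) (hσ : ∀ i, 0 < σ i)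
    (hβ : ∀ i, IsBrownianBridge P (β i)) (hββ : iIndepFun (fun i ω t => β i t ω) P)
    (hXβ : IndepFun X (fun ω i t => β i t ω) P) (hr : ∀ i, r i < 1)
    {rk : ℕ → Fin n → unitInterval} (hrk1 : ∀ k i, rk k i < 1) (hrrk : ∀ k, r ≤ rk k)
    (hrk : Tendsto rk atTop (𝓝 r)) (B : Set ℝ) :
    Tendsto (fun k => ∫⁻ ω, (posterior (P.map X) σ r (fun i => infoProcess X σ β i (r i) ω) B -
      posterior (P.map X) σ (rk k) (fun i => infoProcess X σ β i (rk k i) ω) B) ∂P)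
      atTop (𝓝 0) := by
  have hprob := hββ.isProbabilityMeasure
  have hprobX : IsProbabilityMeasure (P.map X) := Measure.isProbabilityMeasure_map hX.aemeasurable
  let H : (Fin n → unitInterval) → ℝ → Ω → ℝ≥0∞ := fun r x ω =>
    bayesWeight σ r (fun i => σ i * β i (r i) ω) x
  have hHm : ∀ r, Measurable fun q : ℝ × Ω => H r q.1 q.2 :=
    measurable_bayesWeight_bridge hβ σ
  have hH1 : ∀ r x, Measurable (H r x) := fun r x => (hHm r).comp measurable_prodMk_left
  have hH2 : ∀ r ω, Measurable fun x => H r x ω := fun r ω => (hHm r).comp measurable_prodMk_right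
  have hx : ∀ x, Tendsto (fun k => ∫⁻ ω, (H r x ω - H (rk k) x ω) ∂P) atTop (𝓝 0) := by
    intro x
    refine tendsto_lintegral_sub_of_tendsto_ae (hH1 r x) (fun k => hH1 _ x) ?_ ?_
    · rw [lintegral_bayesWeight_bridge hσ hβ hββ hr x]
      exact ENNReal.one_ne_top
    · filter_upwards [ae_all_iff.2 fun i => (hβ i).continuous] with ω hω
      refine tendsto_bayesWeight hσ hr hrk (tendsto_pi_nhds.2 fun i => ?_) x
      exact (((hω i).tendsto _).comp (tendsto_pi_nhds.1 hrk i)).const_mul _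
  have hint : Tendsto (fun k => ∫⁻ x, ∫⁻ ω, (H r x ω - H (rk k) x ω) ∂P ∂P.map X)
      atTop (𝓝 0) := by
    have h := tendsto_lintegral_of_dominated_convergence (μ := P.map X)
      (F := fun k x => ∫⁻ ω, (H r x ω - H (rk k) x ω) ∂P) (f := fun _ => 0) (fun _ => 1)
      (fun k => ((hHm r).sub (hHm (rk k))).lintegral_prod_right')
      (fun k => ae_of_all _ fun x => ?_) (by simp) (ae_of_all _ hx)
    · simpa using h
    · calc ∫⁻ ω, (H r x ω - H (rk k) x ω) ∂P ≤ ∫⁻ ω, H r x ω ∂P :=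
            lintegral_mono fun ω => tsub_le_self
        _ = 1 := lintegral_bayesWeight_bridge hσ hβ hββ hr x
  have hbound : ∀ k, ∫⁻ ω, (posterior (P.map X) σ r (fun i => infoProcess X σ β i (r i) ω) B -
      posterior (P.map X) σ (rk k) (fun i => infoProcess X σ β i (rk k i) ω) B) ∂P ≤
      2 * ∫⁻ x, ∫⁻ ω, (H r x ω - H (rk k) x ω) ∂P ∂P.map X := by
    intro k
    have hG : Measurable fun p : Fin n → unitInterval → ℝ =>
        posterior (P.map X) σ r (fun i => p i (r i)) B -
          posterior (P.map X) σ (rk k) (fun i => p i (rk k i)) B :=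
      (measurable_posterior_evalAt σ r B).sub (measurable_posterior_evalAt σ (rk k) B)
    -- Because `r ≤ rk k`, both posteriors are functions of the path stopped at `rk k`.
    rw [lintegral_info hX hσ hβ hββ hXβ (hrk1 k) hG fun p => by
      simp [stopAt, min_eq_left (hrrk k _)]]
    have hswap : ∫⁻ x, ∫⁻ ω, (H (rk k) x ω - H r x ω) ∂P ∂P.map X =
        ∫⁻ x, ∫⁻ ω, (H r x ω - H (rk k) x ω) ∂P ∂P.map X := by
      refine lintegral_congr fun x => ?_
      have h1 := lintegral_bayesWeight_bridge hσ hβ hββ hr x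
      have h2 := lintegral_bayesWeight_bridge hσ hβ hββ (hrk1 k) x
      refine lintegral_sub_comm_of_lintegral_eq (hH1 _ x) (hH1 _ x) ?_ (h2.trans h1.symm)
      exact h2.trans_ne ENNReal.one_ne_top
    have htonelli : ∀ r r' : Fin n → unitInterval,
        ∫⁻ ω, ∫⁻ x, (H r x ω - H r' x ω) ∂P.map X ∂P =
          ∫⁻ x, ∫⁻ ω, (H r x ω - H r' x ω) ∂P ∂P.map X := fun r r' =>
      (lintegral_lintegral_swap (f := fun x ω => H r x ω - H r' x ω)
        ((hHm r).sub (hHm r')).aemeasurable).symm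
    have hmass : ∀ (r r' : Fin n → unitInterval) (C : Set ℝ) ω,
        posteriorMass (P.map X) σ r (fun i => σ i * β i (r i) ω) C -
          posteriorMass (P.map X) σ r' (fun i => σ i * β i (r' i) ω) C ≤
            ∫⁻ x, (H r x ω - H r' x ω) ∂P.map X := by
      intro r r' C ω
      simp only [posteriorMass]
      exact (lintegral_sub_le _ _ (hH2 r' ω)).trans (setLIntegral_le_lintegral _ _)
    calc _ ≤ ∫⁻ ω, (∫⁻ x, (H r x ω - H (rk k) x ω) ∂P.map X +
          ∫⁻ x, (H (rk k) x ω - H r x ω) ∂P.map X) ∂P := by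
          refine lintegral_mono_ae ?_
          filter_upwards [posteriorMass_bridge_ne_top hX hσ hβ hββ hXβ hr,
            posteriorMass_bridge_ne_top hX hσ hβ hββ hXβ (hrk1 k)] with ω h1 h2
          simp only [posterior]
          refine (div_sub_div_mul_le (posteriorMass_mono _ _ _)
            (posteriorMass_univ_ne_zero _ _) h1 (posteriorMass_univ_ne_zero _ _) h2).trans ?_
          exact add_le_add (hmass _ _ _ _) (hmass _ _ _ _)
      _ = _ := by
          have hm : Measurable fun ω => ∫⁻ x, (H r x ω - H (rk k) x ω) ∂P.map X :=
            ((hHm r).sub (hHm (rk k))).lintegral_prod_left'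
          rw [lintegral_add_left hm, htonelli, htonelli, hswap, two_mul]
  refine tendsto_of_tendsto_of_tendsto_of_le_of_le tendsto_const_nhds ?_ (fun _ => zero_le) hbound
  simpa using ENNReal.Tendsto.const_mul hint (Or.inr ENNReal.ofNat_ne_top)

end Continuity

/-! ### Last active times of a switching path -/

/-- The last time in `[0,t]` at which the path `f` takes the value `1`. -/
noncomputable def lastOne (f : unitInterval → ℝ) (t : unitInterval) : unitInterval :=
  sSup {u | u ≤ t ∧ f u = 1}

theorem le_lastOne {f : unitInterval → ℝ} {t u : unitInterval} (hu : u ≤ t) (h : f u = 1) :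
    u ≤ lastOne f t :=
  le_sSup ⟨hu, h⟩

theorem lastOne_le (f : unitInterval → ℝ) (t : unitInterval) : lastOne f t ≤ t :=
  sSup_le fun _ h => h.1

theorem lastOne_mono (f : unitInterval → ℝ) : Monotone (lastOne f) := fun _ _ h =>
  sSup_le_sSup fun _ hu => ⟨hu.1.trans h, hu.2⟩

theorem exists_forall_Ico_eq {f : unitInterval → ℝ} (h01 : ∀ u, f u = 0 ∨ f u = 1)
    {t : unitInterval} (hf : ContinuousWithinAt f (Set.Ici t) t) (ht : t < 1) :
    ∃ v > t, ∀ u ∈ Set.Ico t v, f u = f t := by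
  have h : ∀ᶠ u in 𝓝[≥] t, f u ∈ Set.Ioo (f t - 1) (f t + 1) :=
    hf (Ioo_mem_nhds (by linarith) (by linarith))
  obtain ⟨v, hv, hvs⟩ := (mem_nhdsGE_iff_exists_Ico_subset' ht).1 h
  refine ⟨v, hv, fun u hu => ?_⟩
  have h1 := hvs hu
  simp only [Set.mem_ofPred_eq, Set.mem_Ioo] at h1
  rcases h01 u with h2 | h2 <;> rcases h01 t with h3 | h3 <;> rw [h2, h3] at h1 ⊢ <;>
    norm_num at h1

/-- If the path is off at `t`, it stays off for a while and the last active time is locally constant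
to the right. If it is on, the last active time at `t` is `t` itself, and a squeeze applies. -/
theorem tendsto_lastOne {f : unitInterval → ℝ} (h01 : ∀ u, f u = 0 ∨ f u = 1)
    {t : unitInterval} (hf : ContinuousWithinAt f (Set.Ici t) t) (ht : t < 1)
    {s : ℕ → unitInterval} (hts : ∀ k, t ≤ s k) (hs : Tendsto s atTop (𝓝 t)) :
    Tendsto (fun k => lastOne f (s k)) atTop (𝓝 (lastOne f t)) := by
  rcases h01 t with h0 | h1
  · obtain ⟨v, hv, hfv⟩ := exists_forall_Ico_eq h01 hf ht
    refine tendsto_const_nhds.congr' ?_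
    filter_upwards [hs.eventually_lt_const hv] with k hk
    refine le_antisymm (lastOne_mono f (hts k)) (sSup_le fun u hu => ?_)
    refine le_lastOne (le_of_not_gt fun htu => ?_) hu.2
    have := hfv u ⟨htu.le, hu.1.trans_lt hk⟩
    rw [hu.2, h0] at this
    exact one_ne_zero this
  · have ht1 : lastOne f t = t := le_antisymm (lastOne_le f t) (le_lastOne le_rfl h1)
    rw [ht1]
    exact tendsto_of_tendsto_of_tendsto_of_le_of_le tendsto_const_nhds hs
      (fun k => le_lastOne (hts k) h1) fun k => lastOne_le f (s k)

/-! ### Recovering the last active time and value from the observation -/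

/-- A sequence that exhausts a dense subset of `[0,t]` containing `t`. -/
noncomputable def timeGrid (t : unitInterval) : ℕ → unitInterval
  | 0 => t
  | k + 1 => min (TopologicalSpace.denseSeq unitInterval k) t

theorem timeGrid_le (t : unitInterval) (k : ℕ) : timeGrid t k ≤ t := by
  cases k with
  | zero => exact le_rfl
  | succ k => exact min_le_right _ _

open Classical in
/-- The last of the times `d 0, …, d (k - 1)` at which the first component of `o` is `1`, together
with the second component of `o` at this time. -/
noncomputable def lastObserved (d : ℕ → unitInterval) (o : unitInterval → ℝ × ℝ) :
    ℕ → unitInterval × ℝ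
  -- The default agrees with `sSup ∅ = 0` and with information paths starting at zero almost surely.
  | 0 => (0, 0)
  | k + 1 => if (o (d k)).1 = 1 ∧ (lastObserved d o k).1 ≤ d k then (d k, (o (d k)).2)
      else lastObserved d o k

theorem measurable_lastObserved (d : ℕ → unitInterval) (k : ℕ) :
    Measurable fun o => lastObserved d o k := by
  induction k with
  | zero => exact measurable_const
  | succ k ih =>
    have ho : Measurable fun o : unitInterval → ℝ × ℝ => o (d k) := measurable_pi_apply (d k)
    refine Measurable.ite ?_ (measurable_const.prodMk (measurable_snd.comp ho)) ih
    have ih1 : Measurable fun o => (lastObserved d o k).1 := measurable_fst.comp ih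
    have hle : MeasurableSet {o | (lastObserved d o k).1 ≤ d k} :=
      measurableSet_le ih1 measurable_const
    exact ((measurable_fst.comp ho) (measurableSet_singleton 1)).inter hle

theorem lastObserved_fst_mono (d : ℕ → unitInterval) (o : unitInterval → ℝ × ℝ) :
    Monotone fun k => (lastObserved d o k).1 := by
  refine monotone_nat_of_le_succ fun k => ?_
  rw [lastObserved]
  split_ifs with h
  · exact h.2
  · exact le_rfl

theorem le_lastObserved_fst {d : ℕ → unitInterval} {o : unitInterval → ℝ × ℝ} {k : ℕ}
    (h : (o (d k)).1 = 1) : d k ≤ (lastObserved d o (k + 1)).1 := by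
  rw [lastObserved]
  split_ifs with h1
  · exact le_rfl
  · exact (lt_of_not_ge fun h2 => h1 ⟨h, h2⟩).le

/-- The last active time, as a measurable function of the observation. -/
noncomputable def observedTime (t : unitInterval) (o : unitInterval → ℝ × ℝ) : unitInterval :=
  ⨆ k, (lastObserved (timeGrid t) o k).1

/-- The last observed value, as a measurable function of the observation. -/
noncomputable def observedValue (t : unitInterval) (o : unitInterval → ℝ × ℝ) : ℝ :=
  limsup (fun k => (lastObserved (timeGrid t) o k).2) atTop

theorem measurable_observedTime (t : unitInterval) : Measurable (observedTime t) :=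
  Measurable.iSup fun k => measurable_fst.comp (measurable_lastObserved _ k)

theorem measurable_observedValue (t : unitInterval) : Measurable (observedValue t) :=
  Measurable.limsup fun k => measurable_snd.comp (measurable_lastObserved _ k)

section Observed

variable {f p : unitInterval → ℝ} {t : unitInterval} {o : unitInterval → ℝ × ℝ}

theorem lastObserved_spec (hp0 : p 0 = 0) (ho : ∀ u ≤ t, o u = (f u, f u * p u)) (k : ℕ) :
    (lastObserved (timeGrid t) o k).1 ≤ lastOne f t ∧
      (lastObserved (timeGrid t) o k).2 = p (lastObserved (timeGrid t) o k).1 := by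
  induction k with
  | zero => exact ⟨bot_le, hp0.symm⟩
  | succ k ih =>
    rw [lastObserved]
    split_ifs with h
    · rw [ho _ (timeGrid_le t k)] at h ⊢
      exact ⟨le_lastOne (timeGrid_le t k) h.1, by simp only at h ⊢; rw [h.1, one_mul]⟩
    · exact ih

theorem observedTime_eq (h01 : ∀ u, f u = 0 ∨ f u = 1)
    (hf : ∀ u, ContinuousWithinAt f (Set.Ici u) u) (hp0 : p 0 = 0)
    (ho : ∀ u ≤ t, o u = (f u, f u * p u)) : observedTime t o = lastOne f t := by
  refine le_antisymm (iSup_le fun k => (lastObserved_spec hp0 ho k).1) (sSup_le fun u hu => ?_)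
  suffices h : ∃ k, u ≤ timeGrid t k ∧ f (timeGrid t k) = 1 by
    obtain ⟨k, hk, hfk⟩ := h
    refine (hk.trans (le_lastObserved_fst ?_)).trans
      (le_iSup (fun k => (lastObserved (timeGrid t) o k).1) (k + 1))
    rw [ho _ (timeGrid_le t k)]
    exact hfk
  rcases hu.1.eq_or_lt with rfl | hut
  -- The endpoint `t` needs its own grid point: the source may have been switched on exactly at `t`.
  -- Any earlier active time is followed by an interval of activity, which meets the dense set.
  · exact ⟨0, le_rfl, hu.2⟩
  · obtain ⟨v, hv, hfv⟩ := exists_forall_Ico_eq h01 (hf u) (hut.trans_le unitInterval.le_one')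
    obtain ⟨k, hk⟩ := (TopologicalSpace.denseRange_denseSeq unitInterval).exists_mem_open
      isOpen_Ioo (Set.nonempty_Ioo.2 (lt_min hv hut))
    have hkt : timeGrid t (k + 1) = TopologicalSpace.denseSeq unitInterval k :=
      min_eq_left (hk.2.trans_le (min_le_right _ _)).le
    refine ⟨k + 1, hkt ▸ hk.1.le, ?_⟩
    rw [hkt, hfv _ ⟨hk.1.le, hk.2.trans_le (min_le_left _ _)⟩, hu.2]

theorem observedValue_eq (h01 : ∀ u, f u = 0 ∨ f u = 1)
    (hf : ∀ u, ContinuousWithinAt f (Set.Ici u) u) (hp : Continuous p) (hp0 : p 0 = 0)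
    (ho : ∀ u ≤ t, o u = (f u, f u * p u)) : observedValue t o = p (lastOne f t) := by
  rw [observedValue, ← observedTime_eq h01 hf hp0 ho]
  simp only [(lastObserved_spec hp0 ho _).2]
  -- The recorded times increase to the last active time, so by continuity of `p` the limsup is a
  -- limit.
  exact ((hp.tendsto _).comp (tendsto_atTop_iSup (lastObserved_fst_mono _ _))).limsup_eq

end Observed

/-- The observation up to time `t` of the paths `p`, modulated by the switching path `j`. -/
def observation {n : ℕ} (t : unitInterval) (j : unitInterval → Fin n → ℝ)
    (p : Fin n → unitInterval → ℝ) : Fin n → unitInterval → ℝ × ℝ :=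
  fun i u => (j (min u t) i, j (min u t) i * p i (min u t))

/-- The last active times and the last observed values, as functions of the observation. -/
noncomputable def observedState {n : ℕ} (t : unitInterval) (o : Fin n → unitInterval → ℝ × ℝ) :
    (Fin n → unitInterval) × (Fin n → ℝ) :=
  (fun i => observedTime t (o i), fun i => observedValue t (o i))

section Observation

variable {n : ℕ} {t : unitInterval}

theorem measurable_observation (t : unitInterval) :
    Measurable fun q : (unitInterval → Fin n → ℝ) × (Fin n → unitInterval → ℝ) =>
      observation t q.1 q.2 := by
  refine measurable_pi_iff.2 fun i => measurable_pi_iff.2 fun u => ?_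
  have h1 : Measurable fun q : (unitInterval → Fin n → ℝ) × (Fin n → unitInterval → ℝ) =>
      q.1 (min u t) i :=
    (measurable_pi_apply i).comp ((measurable_pi_apply (min u t)).comp measurable_fst)
  have h2 : Measurable fun q : (unitInterval → Fin n → ℝ) × (Fin n → unitInterval → ℝ) =>
      q.2 i (min u t) :=
    (measurable_pi_apply (min u t)).comp ((measurable_pi_apply i).comp measurable_snd)
  exact h1.prodMk (h1.mul h2)

theorem measurable_observedState (t : unitInterval) :
    Measurable (observedState (n := n) t) := by
  refine Measurable.prodMk (measurable_pi_iff.2 fun i => ?_) (measurable_pi_iff.2 fun i => ?_)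
  · exact (measurable_observedTime t).comp (measurable_pi_apply i)
  · exact (measurable_observedValue t).comp (measurable_pi_apply i)

/-- A coordinate is visible only while active, hence only up to its last active time; stopping there
loses nothing. This is the invariance required by Bayes' formula at deterministic times. -/
theorem observation_stopAt {j : unitInterval → Fin n → ℝ} (h01 : ∀ u i, j u i = 0 ∨ j u i = 1)
    (p : Fin n → unitInterval → ℝ) :
    observation t j (stopAt (fun i => lastOne (fun u => j u i) t) p) = observation t j p := by
  ext i u
  · rfl
  · simp only [observation, stopAt]
    rcases h01 (min u t) i with h | h
    · simp [h]
    · rw [min_eq_left (le_lastOne (f := fun u => j u i) (min_le_right u t) h)]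

theorem IsCadlag.continuousWithinAt_apply {j : unitInterval → Fin n → ℝ} (hj : IsCadlag j)
    (i : Fin n) (u : unitInterval) :
    ContinuousWithinAt (fun u => j u i) (Set.Ici u) u :=
  continuousWithinAt_pi.1 (hj u).1 i

theorem observedState_observation {j : unitInterval → Fin n → ℝ}
    (h01 : ∀ u i, j u i = 0 ∨ j u i = 1) (hj : IsCadlag j)
    {p : Fin n → unitInterval → ℝ} (hp : ∀ i, Continuous (p i)) (hp0 : ∀ i, p i 0 = 0) :
    observedState t (observation t j p) = (fun i => lastOne (fun u => j u i) t,
      fun i => p i (lastOne (fun u => j u i) t)) := by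
  have ho : ∀ i, ∀ u ≤ t, observation t j p i u = (j u i, j u i * p i u) := fun i u hu => by
    simp [observation, min_eq_left hu]
  have h1 : ∀ i, observedTime t (observation t j p i) = lastOne (fun u => j u i) t := fun i =>
    observedTime_eq (fun u => h01 u i) (hj.continuousWithinAt_apply i) (hp0 i) (ho i)
  have h2 : ∀ i, observedValue t (observation t j p i) = p i (lastOne (fun u => j u i) t) :=
    fun i => observedValue_eq (fun u => h01 u i) (hj.continuousWithinAt_apply i) (hp i) (hp0 i)
      (ho i)
  simp only [observedState, h1, h2]

end Observation

/-! ### Random switching: freezing the switching path -/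

section Switching

variable {Ω : Type*} [MeasurableSpace Ω] {P : Measure Ω} {n : ℕ} {σ : Fin n → ℝ}
  {β : Fin n → unitInterval → Ω → ℝ} {X : Ω → ℝ} {J : unitInterval → Ω → Fin n → ℝ}

theorem IsSwitchingProcess.measurable_path (hJ : IsSwitchingProcess P J) :
    Measurable fun ω t => J t ω :=
  measurable_pi_iff.2 hJ.measurable

theorem ae_infoProcess_regular (hβ : ∀ i, IsBrownianBridge P (β i)) (X : Ω → ℝ) (σ : Fin n → ℝ) :
    ∀ᵐ ω ∂P, ∀ i, (Continuous fun u => infoProcess X σ β i u ω) ∧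
      infoProcess X σ β i 0 ω = 0 := by
  refine ae_all_iff.2 fun i => ?_
  filter_upwards [(hβ i).continuous, (hβ i).ae_eq_zero (t := 0) (Or.inl rfl)] with ω h1 h2
  refine ⟨?_, by simp [infoProcess, h2]⟩
  exact (continuous_subtype_val.mul continuous_const).add (continuous_const.mul h1)

/-- The signal is the terminal value of any information process, since bridges vanish at time one;
thus independence from `ξ` already gives independence from `(X, ξ)`. With no sources, the switching
process is constant. -/
theorem indepFun_switching_signal_info [IsProbabilityMeasure P]
    (hβ : ∀ i, IsBrownianBridge P (β i))
    (hJξ : IndepFun (fun ω t => J t ω) (fun ω i t => infoProcess X σ β i t ω) P) :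
    IndepFun (fun ω t => J t ω) (fun ω => (X ω, fun i t => infoProcess X σ β i t ω)) P := by
  rcases Nat.eq_zero_or_pos n with rfl | hn
  · have : (fun ω t => J t ω) = fun _ => (fun _ => 0 : unitInterval → Fin 0 → ℝ) :=
      Subsingleton.elim _ _
    rw [this]
    exact indepFun_const_left _ _
  · let i : Fin n := ⟨0, hn⟩
    have hψ : Measurable fun p : Fin n → unitInterval → ℝ => (p i 1, p) :=
      ((measurable_pi_apply (1 : unitInterval)).comp (measurable_pi_apply i)).prodMk measurable_id
    refine (hJξ.comp measurable_id hψ).congr EventuallyEq.rfl ?_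
    filter_upwards [(hβ i).ae_eq_zero (t := 1) (Or.inr rfl)] with ω hω
    simp [infoProcess, hω]

theorem measurable_lintegral_switching [SFinite P] (hX : Measurable X)
    (hβ : ∀ i, IsBrownianBridge P (β i)) (hJ : IsSwitchingProcess P J)
    {F : (unitInterval → Fin n → ℝ) × (ℝ × (Fin n → unitInterval → ℝ)) → ℝ≥0∞}
    (hF : Measurable F) :
    Measurable fun ω₁ => ∫⁻ ω₂, F (fun t => J t ω₁,
      (X ω₂, fun i t => infoProcess X σ β i t ω₂)) ∂P := by
  have h : Measurable fun q : Ω × Ω => ((fun t => J t q.1 : unitInterval → Fin n → ℝ),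
      (X q.2, fun i t => infoProcess X σ β i t q.2)) :=
    (hJ.measurable_path.comp measurable_fst).prodMk
      ((hX.prodMk (measurable_infoPath hX hβ σ)).comp measurable_snd)
  exact (hF.comp h).lintegral_prod_right'

theorem lintegral_switching [IsProbabilityMeasure P] (hX : Measurable X)
    (hβ : ∀ i, IsBrownianBridge P (β i)) (hJ : IsSwitchingProcess P J)
    (hJξ : IndepFun (fun ω t => J t ω) (fun ω i t => infoProcess X σ β i t ω) P)
    {F : (unitInterval → Fin n → ℝ) × (ℝ × (Fin n → unitInterval → ℝ)) → ℝ≥0∞}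
    (hF : Measurable F) :
    ∫⁻ ω, F (fun t => J t ω, (X ω, fun i t => infoProcess X σ β i t ω)) ∂P =
      ∫⁻ ω₁, ∫⁻ ω₂, F (fun t => J t ω₁, (X ω₂, fun i t => infoProcess X σ β i t ω₂)) ∂P ∂P := by
  have hJm := hJ.measurable_path
  have hW : Measurable fun ω => (X ω, fun i t => infoProcess X σ β i t ω) :=
    hX.prodMk (measurable_infoPath hX hβ σ)
  have hprod := (indepFun_iff_map_prod_eq_prod_map_map hJm.aemeasurable hW.aemeasurable).1
    (indepFun_switching_signal_info hβ hJξ)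
  have h1 := lintegral_map hF (hJm.prodMk hW) (μ := P)
  rw [hprod, lintegral_prod _ hF.aemeasurable,
    lintegral_map hF.lintegral_prod_right' hJm] at h1
  refine h1.symm.trans (lintegral_congr fun ω₁ => ?_)
  exact lintegral_map (f := fun w => F (fun t => J t ω₁, w)) (hF.comp measurable_prodMk_left) hW

/-- The posterior probability of `B` given the observation up to time `t`. -/
noncomputable def posteriorAt (P : Measure Ω) (X : Ω → ℝ) (σ : Fin n → ℝ)
    (β : Fin n → unitInterval → Ω → ℝ) (J : unitInterval → Ω → Fin n → ℝ) (t : unitInterval)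
    (B : Set ℝ) (ω : Ω) : ℝ≥0∞ :=
  posterior (P.map X) σ (fun i => lastOne (fun u => J u ω i) t)
    (fun i => infoProcess X σ β i (lastOne (fun u => J u ω i) t) ω) B

/-- The exceptional sets for the switching path and for the information path are kept apart, as
needed after Fubini. -/
theorem ae_observedState_eq (hβ : ∀ i, IsBrownianBridge P (β i)) (hJ : IsSwitchingProcess P J)
    (t : unitInterval) : ∀ᵐ ω₁ ∂P, ∀ᵐ ω₂ ∂P,
      observedState t (observation t (fun t => J t ω₁) fun i u => infoProcess X σ β i u ω₂) =
        (fun i => lastOne (fun u => J u ω₁ i) t,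
          fun i => infoProcess X σ β i (lastOne (fun u => J u ω₁ i) t) ω₂) := by
  filter_upwards [hJ.cadlag] with ω₁ h1
  filter_upwards [ae_infoProcess_regular hβ X σ] with ω₂ h2
  exact observedState_observation (fun u i => hJ.zero_or_one u ω₁ i) h1 (fun i => (h2 i).1)
    fun i => (h2 i).2

theorem ae_observedState_eq_diag (hβ : ∀ i, IsBrownianBridge P (β i))
    (hJ : IsSwitchingProcess P J) (t : unitInterval) : ∀ᵐ ω ∂P,
      observedState t (observation t (fun t => J t ω) fun i u => infoProcess X σ β i u ω) =
        (fun i => lastOne (fun u => J u ω i) t,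
          fun i => infoProcess X σ β i (lastOne (fun u => J u ω i) t) ω) := by
  filter_upwards [hJ.cadlag, ae_infoProcess_regular hβ X σ] with ω h1 h2
  exact observedState_observation (fun u i => hJ.zero_or_one u ω i) h1 (fun i => (h2 i).1)
    fun i => (h2 i).2

/-- The last active time is an uncountable supremum; this lemma replaces it, up to a null set, by a
measurable function of the observation. -/
theorem posteriorAt_ae_eq (hβ : ∀ i, IsBrownianBridge P (β i)) (hJ : IsSwitchingProcess P J)
    (t : unitInterval) (B : Set ℝ) :
    posteriorAt P X σ β J t B =ᵐ[P] fun ω =>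
      (fun q : (Fin n → unitInterval) × (Fin n → ℝ) => posterior (P.map X) σ q.1 q.2 B)
        (observedState t
          (observation t (fun t => J t ω) fun i u => infoProcess X σ β i u ω)) := by
  filter_upwards [ae_observedState_eq_diag hβ hJ t] with ω hω
  rw [hω, posteriorAt]

theorem measurable_switchedObservation (t : unitInterval) :
    Measurable fun q : (unitInterval → Fin n → ℝ) × (ℝ × (Fin n → unitInterval → ℝ)) =>
      observation t q.1 q.2.2 := by
  have h : Measurable fun q : (unitInterval → Fin n → ℝ) × (ℝ × (Fin n → unitInterval → ℝ)) =>
      (q.1, q.2.2) := measurable_fst.prodMk (measurable_snd.comp measurable_snd)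
  exact (measurable_observation t).comp h

theorem measurable_observation_right (t : unitInterval) (j : unitInterval → Fin n → ℝ) :
    Measurable fun p : Fin n → unitInterval → ℝ => observation t j p := by
  have h : Measurable fun p : Fin n → unitInterval → ℝ => (j, p) := measurable_prodMk_left
  exact (measurable_observation t).comp h

theorem lastOne_lt_one {f : unitInterval → ℝ} {t : unitInterval} (ht : t < 1) :
    lastOne f t < 1 :=
  (lastOne_le f t).trans_lt ht

/-- The posterior is the conditional distribution of the signal given the observation. -/
theorem lintegral_indicator_mul_observation [IsProbabilityMeasure P] (hX : Measurable X)
    (hσ : ∀ i, 0 < σ i) (hβ : ∀ i, IsBrownianBridge P (β i))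
    (hββ : iIndepFun (fun i ω t => β i t ω) P) (hXβ : IndepFun X (fun ω i t => β i t ω) P)
    (hJ : IsSwitchingProcess P J)
    (hJξ : IndepFun (fun ω t => J t ω) (fun ω i t => infoProcess X σ β i t ω) P)
    {t : unitInterval} (ht : t < 1) {B : Set ℝ} (hB : MeasurableSet B)
    {Φ : (Fin n → unitInterval → ℝ × ℝ) → ℝ≥0∞} (hΦ : Measurable Φ) :
    ∫⁻ ω, B.indicator 1 (X ω) *
        Φ (observation t (fun t => J t ω) fun i u => infoProcess X σ β i u ω) ∂P =
      ∫⁻ ω, posteriorAt P X σ β J t B ω *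
        Φ (observation t (fun t => J t ω) fun i u => infoProcess X σ β i u ω) ∂P := by
  have hO := measurable_switchedObservation (n := n) t
  have hpost := measurable_posterior (ν := P.map X) σ B
  have hF1 : Measurable fun q : (unitInterval → Fin n → ℝ) × (ℝ × (Fin n → unitInterval → ℝ)) =>
      B.indicator (1 : ℝ → ℝ≥0∞) q.2.1 * Φ (observation t q.1 q.2.2) :=
    ((measurable_one.indicator hB).comp (measurable_fst.comp measurable_snd)).mul (hΦ.comp hO)
  have hF2 : Measurable fun q : (unitInterval → Fin n → ℝ) × (ℝ × (Fin n → unitInterval → ℝ)) =>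
      (fun s : (Fin n → unitInterval) × (Fin n → ℝ) => posterior (P.map X) σ s.1 s.2 B)
        (observedState t (observation t q.1 q.2.2)) * Φ (observation t q.1 q.2.2) :=
    (hpost.comp ((measurable_observedState t).comp hO)).mul (hΦ.comp hO)
  have e1 := lintegral_switching hX hβ hJ hJξ hF1
  have e2 := lintegral_switching hX hβ hJ hJξ hF2
  refine e1.trans (Eq.trans (lintegral_congr_ae ?_) (e2.symm.trans (lintegral_congr_ae ?_)))
  · filter_upwards [ae_observedState_eq (X := X) (σ := σ) hβ hJ t] with ω₁ h1
    have h := lintegral_indicator_mul_info_eq_posterior hX hσ hβ hββ hXβ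
      (r := fun i => lastOne (fun u => J u ω₁ i) t) (fun i => lastOne_lt_one ht) hB
      (hΦ.comp (measurable_observation_right t fun t => J t ω₁)) fun p => by
        simp only [Function.comp_apply]
        rw [observation_stopAt (j := fun t => J t ω₁) fun u i => hJ.zero_or_one u ω₁ i]
    refine h.trans (lintegral_congr_ae ?_)
    filter_upwards [h1] with ω₂ h2
    simp only [h2, Function.comp_apply]
  · filter_upwards [posteriorAt_ae_eq (X := X) (σ := σ) hβ hJ t B] with ω hω
    rw [hω]

theorem ae_posteriorMass_ne_top [IsProbabilityMeasure P] (hX : Measurable X)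
    (hσ : ∀ i, 0 < σ i) (hβ : ∀ i, IsBrownianBridge P (β i))
    (hββ : iIndepFun (fun i ω t => β i t ω) P) (hXβ : IndepFun X (fun ω i t => β i t ω) P)
    (hJ : IsSwitchingProcess P J)
    (hJξ : IndepFun (fun ω t => J t ω) (fun ω i t => infoProcess X σ β i t ω) P)
    {t : unitInterval} (ht : t < 1) :
    ∀ᵐ ω ∂P, posteriorMass (P.map X) σ (fun i => lastOne (fun u => J u ω i) t)
      (fun i => infoProcess X σ β i (lastOne (fun u => J u ω i) t) ω) Set.univ ≠ ∞ := by
  let S : Set ((Fin n → unitInterval) × (Fin n → ℝ)) :=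
    {q | posteriorMass (P.map X) σ q.1 q.2 Set.univ = ∞}
  have hS : MeasurableSet S := measurable_posteriorMass σ Set.univ (measurableSet_singleton ∞)
  have hO := measurable_switchedObservation (n := n) t
  have hF : Measurable fun q : (unitInterval → Fin n → ℝ) × (ℝ × (Fin n → unitInterval → ℝ)) =>
      S.indicator (1 : (Fin n → unitInterval) × (Fin n → ℝ) → ℝ≥0∞)
        (observedState t (observation t q.1 q.2.2)) :=
    (measurable_one.indicator hS).comp ((measurable_observedState t).comp hO)
  have e := lintegral_switching hX hβ hJ hJξ hF
  have h0 : ∫⁻ ω₁, ∫⁻ ω₂, S.indicator (1 : (Fin n → unitInterval) × (Fin n → ℝ) → ℝ≥0∞)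
      (observedState t (observation t (fun t => J t ω₁)
        fun i u => infoProcess X σ β i u ω₂)) ∂P ∂P = 0 := by
    refine lintegral_eq_zero_of_ae_eq_zero ?_
    filter_upwards [ae_observedState_eq (X := X) (σ := σ) hβ hJ t] with ω₁ h1
    refine lintegral_eq_zero_of_ae_eq_zero ?_
    filter_upwards [h1, posteriorMass_info_ne_top hX hσ hβ hββ hXβ
      (r := fun i => lastOne (fun u => J u ω₁ i) t) (fun i => lastOne_lt_one ht)] with ω₂ h2 h3
    rw [h2]
    simp [S, h3]
  have hm : Measurable fun ω => S.indicator (1 : (Fin n → unitInterval) × (Fin n → ℝ) → ℝ≥0∞)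
      (observedState t (observation t (fun t => J t ω)
        fun i u => infoProcess X σ β i u ω)) :=
    hF.comp (hJ.measurable_path.prodMk (hX.prodMk (measurable_infoPath hX hβ σ)))
  rw [h0, lintegral_eq_zero_iff hm] at e
  filter_upwards [e, ae_observedState_eq_diag (X := X) (σ := σ) hβ hJ t] with ω h1 h2
  rw [h2] at h1
  simpa [S, Set.indicator] using h1

/-- For almost every frozen switching path the inner integral tends to zero by `tendsto_lastOne` and
`tendsto_lintegral_posterior_sub`; dominated convergence with bound one does the rest. -/
theorem tendsto_lintegral_posteriorAt_sub [IsProbabilityMeasure P] (hX : Measurable X)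
    (hσ : ∀ i, 0 < σ i) (hβ : ∀ i, IsBrownianBridge P (β i))
    (hββ : iIndepFun (fun i ω t => β i t ω) P) (hXβ : IndepFun X (fun ω i t => β i t ω) P)
    (hJ : IsSwitchingProcess P J)
    (hJξ : IndepFun (fun ω t => J t ω) (fun ω i t => infoProcess X σ β i t ω) P)
    {t : unitInterval} {s : ℕ → unitInterval} (hts : ∀ k, t ≤ s k) (hs1 : ∀ k, s k < 1)
    (hs : Tendsto s atTop (𝓝 t)) (B : Set ℝ) :
    Tendsto (fun k => ∫⁻ ω, (posteriorAt P X σ β J t B ω -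
      posteriorAt P X σ β J (s k) B ω) ∂P) atTop (𝓝 0) := by
  have ht : t < 1 := (hts 0).trans_lt (hs1 0)
  let V : unitInterval → (unitInterval → Fin n → ℝ) × (ℝ × (Fin n → unitInterval → ℝ)) → ℝ≥0∞ :=
    fun t q => (fun s : (Fin n → unitInterval) × (Fin n → ℝ) => posterior (P.map X) σ s.1 s.2 B)
      (observedState t (observation t q.1 q.2.2))
  have hV : ∀ t, Measurable (V t) := fun t =>
    (measurable_posterior (ν := P.map X) σ B).comp
      ((measurable_observedState t).comp (measurable_switchedObservation t))
  have hV1 : ∀ t q, V t q ≤ 1 := fun t q => posterior_le_one _ _ _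
  have hF : ∀ k, Measurable fun q => V t q - V (s k) q := fun k => (hV t).sub (hV (s k))
  have e : ∀ k, ∫⁻ ω, (posteriorAt P X σ β J t B ω - posteriorAt P X σ β J (s k) B ω) ∂P =
      ∫⁻ ω₁, ∫⁻ ω₂, (V t (fun t => J t ω₁, (X ω₂, fun i u => infoProcess X σ β i u ω₂)) -
        V (s k) (fun t => J t ω₁, (X ω₂, fun i u => infoProcess X σ β i u ω₂))) ∂P ∂P := by
    intro k
    rw [← lintegral_switching hX hβ hJ hJξ (hF k)]
    refine lintegral_congr_ae ?_
    filter_upwards [posteriorAt_ae_eq (X := X) (σ := σ) hβ hJ t B,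
      posteriorAt_ae_eq (X := X) (σ := σ) hβ hJ (s k) B] with ω h1 h2
    rw [h1, h2]
  simp only [e]
  have h := tendsto_lintegral_of_dominated_convergence (μ := P) (F := fun k ω₁ =>
    ∫⁻ ω₂, (V t (fun t => J t ω₁, (X ω₂, fun i u => infoProcess X σ β i u ω₂)) -
      V (s k) (fun t => J t ω₁, (X ω₂, fun i u => infoProcess X σ β i u ω₂))) ∂P)
    (f := fun _ => 0) (fun _ => 1) (fun k => measurable_lintegral_switching hX hβ hJ (hF k))
    (fun k => ae_of_all _ fun ω₁ => ?_) (by simp) ?_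
  · simpa using h
  · refine (lintegral_mono fun ω₂ => tsub_le_self.trans (hV1 _ _)).trans ?_
    simp
  · filter_upwards [ae_observedState_eq (X := X) (σ := σ) hβ hJ t, hJ.cadlag,
      ae_all_iff.2 fun k => ae_observedState_eq (X := X) (σ := σ) hβ hJ (s k)] with ω₁ h1 hc h2
    have hlim := tendsto_lintegral_posterior_sub hX hσ hβ hββ hXβ
      (r := fun i => lastOne (fun u => J u ω₁ i) t) (fun i => lastOne_lt_one ht)
      (rk := fun k i => lastOne (fun u => J u ω₁ i) (s k)) (fun k i => lastOne_lt_one (hs1 k))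
      (fun k i => lastOne_mono _ (hts k))
      (tendsto_pi_nhds.2 fun i => tendsto_lastOne (fun u => hJ.zero_or_one u ω₁ i)
        (hc.continuousWithinAt_apply i t) ht hts hs) B
    refine hlim.congr fun k => lintegral_congr_ae ?_
    filter_upwards [h1, h2 k] with ω₂ h3 h4
    simp only [V, h3, h4]

end Switching

/-! ### The raw σ-algebra is generated by the observation -/

section Sigma

variable {Ω : Type*} {n : ℕ} {X : Ω → ℝ} {J : unitInterval → Ω → Fin n → ℝ}
  {ξ : Fin n → unitInterval → Ω → ℝ} {t : unitInterval}

theorem modulatedProcess_apply (J : unitInterval → Ω → Fin n → ℝ)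
    (ξ : Fin n → unitInterval → Ω → ℝ) (u : unitInterval) (ω : Ω) (i : Fin n) :
    modulatedProcess J ξ u ω i = J u ω i * ξ i u ω := by
  simp [modulatedProcess, switchMatrix, Matrix.mulVec_diagonal]

theorem lastActive_eq_lastOne (J : unitInterval → Ω → Fin n → ℝ) (i : Fin n) (t : unitInterval)
    (ω : Ω) : lastActive J i t ω = lastOne (fun u => J u ω i) t := by
  simp [lastActive, lastOne, switchMatrix]

theorem modulatedSigma_le_comap_observation (ht : t < 1) :
    modulatedSigma X J ξ t ≤ MeasurableSpace.comap
      (fun ω => observation t (fun u => J u ω) fun i u => ξ i u ω) inferInstance := by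
  let m : MeasurableSpace Ω := MeasurableSpace.comap
    (fun ω => observation t (fun u => J u ω) fun i u => ξ i u ω) inferInstance
  have hO : Measurable[m] fun ω => observation t (fun u => J u ω) fun i u => ξ i u ω :=
    comap_measurable _
  have hOi : ∀ i u, Measurable[m] fun ω =>
      observation t (fun u => J u ω) (fun i u => ξ i u ω) i u := fun i u =>
    (measurable_pi_apply u).comp ((measurable_pi_apply i).comp hO)
  refine sup_le (sup_le ?_ ?_) ?_
  · refine iSup₂_le fun u hu => measurable_iff_comap_le.1 (measurable_pi_iff.2 fun i => ?_)
    have h := (measurable_snd (α := ℝ) (β := ℝ)).comp (hOi i u)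
    convert h using 2 with ω
    simp [modulatedProcess_apply, observation, min_eq_left hu]
  · refine iSup₂_le fun u hu => iSup₂_le fun i j => measurable_iff_comap_le.1 ?_
    by_cases hij : i = j
    · subst hij
      have h := (measurable_fst (α := ℝ) (β := ℝ)).comp (hOi i u)
      convert h using 2 with ω
      simp [switchMatrix, observation, min_eq_left hu]
    · simp only [switchMatrix, Matrix.diagonal_apply_ne _ hij]
      exact measurable_const
  · simp only [ht.ne, if_false]
    exact measurable_iff_comap_le.1 measurable_const

theorem measurable_observation_modulatedSigma :
    Measurable[modulatedSigma X J ξ t]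
      fun ω => observation t (fun u => J u ω) fun i u => ξ i u ω := by
  let m : MeasurableSpace Ω := modulatedSigma X J ξ t
  refine measurable_pi_iff.2 fun i => measurable_pi_iff.2 fun u => ?_
  have h1 : Measurable[m] fun ω => switchMatrix J (min u t) ω i i := by
    refine measurable_iff_comap_le.2 (le_sup_of_le_left (le_sup_of_le_right ?_))
    exact le_iSup₂_of_le (min u t) (min_le_right u t) (le_iSup₂_of_le i i le_rfl)
  have h2 : Measurable[m] fun ω => modulatedProcess J ξ (min u t) ω := by
    refine measurable_iff_comap_le.2 (le_sup_of_le_left (le_sup_of_le_left ?_))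
    exact le_iSup₂_of_le (min u t) (min_le_right u t) le_rfl
  have h3 : Measurable[m] fun ω => modulatedProcess J ξ (min u t) ω i :=
    (measurable_pi_apply i).comp h2
  have h := h1.prodMk h3
  convert h using 2 with ω
  simp [switchMatrix, modulatedProcess_apply, observation]

end Sigma

/-- The sets that are almost everywhere equal to an `m`-measurable set form a σ-algebra containing
both `m` and the null events. -/
theorem exists_measurableSet_ae_eq_of_sup_nullSigma {Ω : Type*}
    {m mΩ : MeasurableSpace Ω} {P : Measure Ω} {G : Set Ω}
    (hG : MeasurableSet[m ⊔ nullSigma P] G) : ∃ G', MeasurableSet[m] G' ∧ G =ᵐ[P] G' := by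
  have hle : m ⊔ nullSigma P ≤ @eventuallyMeasurableSpace Ω m (ae P) _ := by
    refine sup_le (@le_eventuallyMeasurableSpace Ω m (ae P) _)
      (MeasurableSpace.generateFrom_le fun s hs => ?_)
    exact ⟨∅, @MeasurableSet.empty Ω m, ae_eq_empty.2 hs.2⟩
  exact hle G hG

/-! ### Integral identities on events of the two filtrations -/

section Conditional

variable {Ω : Type*} [mΩ : MeasurableSpace Ω] {P : Measure Ω} {n : ℕ} {σ : Fin n → ℝ}
  {β : Fin n → unitInterval → Ω → ℝ} {X : Ω → ℝ} {J : unitInterval → Ω → Fin n → ℝ}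
  {t : unitInterval} {B : Set ℝ}

theorem measurable_observed_posterior [IsProbabilityMeasure P] (X : Ω → ℝ) (σ : Fin n → ℝ)
    (β : Fin n → unitInterval → Ω → ℝ) (J : unitInterval → Ω → Fin n → ℝ) (t : unitInterval)
    (B : Set ℝ) :
    Measurable[modulatedSigma X J (infoProcess X σ β) t] fun ω =>
      (fun q : (Fin n → unitInterval) × (Fin n → ℝ) => posterior (P.map X) σ q.1 q.2 B)
        (observedState t
          (observation t (fun t => J t ω) fun i u => infoProcess X σ β i u ω)) :=
  ((measurable_posterior (ν := P.map X) σ B).comp (measurable_observedState t)).comp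
    measurable_observation_modulatedSigma

theorem aemeasurable_posteriorAt [IsProbabilityMeasure P] (hX : Measurable X)
    (hβ : ∀ i, IsBrownianBridge P (β i)) (hJ : IsSwitchingProcess P J) (t : unitInterval)
    (B : Set ℝ) : AEMeasurable (posteriorAt P X σ β J t B) P :=
  ⟨_, (measurable_observed_posterior X σ β J t B).mono
    (modulatedSigma_le hX hJ.measurable (measurable_infoProcess hX σ hβ) t) le_rfl,
    posteriorAt_ae_eq hβ hJ t B⟩

theorem setLIntegral_posteriorAt_of_modulatedSigma [IsProbabilityMeasure P] (hX : Measurable X)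
    (hσ : ∀ i, 0 < σ i) (hβ : ∀ i, IsBrownianBridge P (β i))
    (hββ : iIndepFun (fun i ω t => β i t ω) P) (hXβ : IndepFun X (fun ω i t => β i t ω) P)
    (hJ : IsSwitchingProcess P J)
    (hJξ : IndepFun (fun ω t => J t ω) (fun ω i t => infoProcess X σ β i t ω) P)
    (ht : t < 1) (hB : MeasurableSet B) {G : Set Ω}
    (hG : MeasurableSet[modulatedSigma X J (infoProcess X σ β) t] G) :
    ∫⁻ ω in G, B.indicator 1 (X ω) ∂P = ∫⁻ ω in G, posteriorAt P X σ β J t B ω ∂P := by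
  have hGm := modulatedSigma_le hX hJ.measurable (measurable_infoProcess hX σ hβ) t G hG
  obtain ⟨S, hS, rfl⟩ := modulatedSigma_le_comap_observation ht G hG
  have h := lintegral_indicator_mul_observation hX hσ hβ hββ hXβ hJ hJξ ht hB
    (Φ := S.indicator 1) (measurable_one.indicator hS)
  rw [← lintegral_indicator hGm, ← lintegral_indicator hGm]
  convert h using 3 with ω ω <;>
    · simp [Set.indicator]
      rfl

theorem setLIntegral_posteriorAt_of_augmentation [IsProbabilityMeasure P] (hX : Measurable X)
    (hσ : ∀ i, 0 < σ i) (hβ : ∀ i, IsBrownianBridge P (β i))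
    (hββ : iIndepFun (fun i ω t => β i t ω) P) (hXβ : IndepFun X (fun ω i t => β i t ω) P)
    (hJ : IsSwitchingProcess P J)
    (hJξ : IndepFun (fun ω t => J t ω) (fun ω i t => infoProcess X σ β i t ω) P)
    (ht : t < 1) (hB : MeasurableSet B) {G : Set Ω}
    (hG : MeasurableSet[usualAugmentation P (rawFiltration X J (infoProcess X σ β) hX
      hJ.measurable (measurable_infoProcess hX σ hβ)) t] G) :
    ∫⁻ ω in G, B.indicator 1 (X ω) ∂P = ∫⁻ ω in G, posteriorAt P X σ β J t B ω ∂P := by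
  have hGm := (usualAugmentation P (rawFiltration X J (infoProcess X σ β) hX
    hJ.measurable (measurable_infoProcess hX σ hβ))).le t G hG
  have hmax : ¬IsMax t := fun h => ht.not_ge (h unitInterval.le_one')
  rw [usualAugmentation, Filtration.rightCont_eq_of_not_isMax _ hmax] at hG
  have hs : ∀ s, t < s → s < 1 → ∀ C : Set ℝ, MeasurableSet C →
      ∫⁻ ω in G, C.indicator 1 (X ω) ∂P = ∫⁻ ω in G, posteriorAt P X σ β J s C ω ∂P := by
    intro s hts hs1 C hC
    have hGs : MeasurableSet[modulatedSigma X J (infoProcess X σ β) s ⊔ nullSigma P] G :=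
      (iInf₂_le (α := MeasurableSpace Ω) s hts) G hG
    obtain ⟨G', hG', hGG'⟩ := exists_measurableSet_ae_eq_of_sup_nullSigma hGs
    rw [setLIntegral_congr hGG', setLIntegral_congr hGG']
    exact setLIntegral_posteriorAt_of_modulatedSigma hX hσ hβ hββ hXβ hJ hJξ hs1 hC hG'
  obtain ⟨s, -, hsmem, hslim⟩ := exists_seq_strictAnti_tendsto' ht
  -- Only the positive part of the posterior's decrease is known to vanish, so the limit gives an
  -- inequality.
  have hle : ∀ C : Set ℝ, MeasurableSet C →
      ∫⁻ ω in G, posteriorAt P X σ β J t C ω ∂P ≤ ∫⁻ ω in G, C.indicator 1 (X ω) ∂P := by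
    intro C hC
    have hlim := (tendsto_lintegral_posteriorAt_sub hX hσ hβ hββ hXβ hJ hJξ
      (fun k => (hsmem k).1.le) (fun k => (hsmem k).2) hslim C).const_add
        (∫⁻ ω in G, C.indicator 1 (X ω) ∂P)
    rw [add_zero] at hlim
    refine ge_of_tendsto' hlim fun k => ?_
    rw [hs (s k) (hsmem k).1 (hsmem k).2 C hC]
    calc ∫⁻ ω in G, posteriorAt P X σ β J t C ω ∂P
        ≤ ∫⁻ ω in G, (posteriorAt P X σ β J (s k) C ω +
          (posteriorAt P X σ β J t C ω - posteriorAt P X σ β J (s k) C ω)) ∂P :=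
          lintegral_mono fun ω => le_add_tsub
      _ = _ := lintegral_add_left' (aemeasurable_posteriorAt hX hβ hJ _ _).restrict _
      _ ≤ _ := add_le_add le_rfl (setLIntegral_le_lintegral _ _)
  have hC1 : ∀ C : Set ℝ, MeasurableSet C → Measurable fun ω => C.indicator (1 : ℝ → ℝ≥0∞) (X ω) :=
    fun C hC => (measurable_one.indicator hC).comp hX
  have hfin : ∀ C : Set ℝ, ∫⁻ ω in G, C.indicator (1 : ℝ → ℝ≥0∞) (X ω) ∂P ≠ ∞ := fun C => by
    refine ((lintegral_mono fun ω => Set.indicator_le_self _ _ _).trans_lt ?_).ne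
    simp
  have hsum : ∫⁻ ω in G, posteriorAt P X σ β J t B ω ∂P +
      ∫⁻ ω in G, posteriorAt P X σ β J t Bᶜ ω ∂P =
        ∫⁻ ω in G, B.indicator 1 (X ω) ∂P + ∫⁻ ω in G, Bᶜ.indicator 1 (X ω) ∂P := by
    have hprobX : IsProbabilityMeasure (P.map X) :=
      Measure.isProbabilityMeasure_map hX.aemeasurable
    rw [← lintegral_add_left' (aemeasurable_posteriorAt hX hβ hJ _ _).restrict,
      ← lintegral_add_left (hC1 B hB)]
    refine lintegral_congr_ae (ae_restrict_of_ae ?_)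
    filter_upwards [ae_posteriorMass_ne_top hX hσ hβ hββ hXβ hJ hJξ ht] with ω hω
    rw [posteriorAt, posteriorAt, posterior_add_compl hB hω]
    by_cases h : X ω ∈ B <;> simp [h]
  -- A strict inequality for `B` together with the inequality for `Bᶜ` would contradict equality of
  -- the finite sums.
  refine le_antisymm ?_ (hle B hB)
  by_contra! hlt
  refine (ENNReal.add_lt_add_of_lt_of_le ?_ hlt (hle Bᶜ hB.compl)).ne hsum
  exact ((hle Bᶜ hB.compl).trans_lt (hfin _).lt_top).ne

end Conditional

/-! ### From integral identities to conditional distributions -/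

section CondDistrib

variable {Ω : Type*} {m mΩ : MeasurableSpace Ω} {P : Measure Ω} {n : ℕ} {σ : Fin n → ℝ}
  {β : Fin n → unitInterval → Ω → ℝ} {𝕏 : Set ℝ} {X : Ω → 𝕏}
  {J : unitInterval → Ω → Fin n → ℝ} {t : unitInterval}

/-- Transfers the formula from the state space `𝕏`, which need not be a Borel set, to the law of the
signal on `ℝ`. -/
theorem normalizedWeight_preimage_coe (hX : Measurable X) (σ : Fin n → ℝ)
    (r : Fin n → unitInterval) (y : Fin n → ℝ) {B : Set ℝ} (hB : MeasurableSet B) :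
    normalizedWeight (P.map X) (fun x : 𝕏 => ∏ i, gaussianWeight x (y i) (r i) (σ i))
      (Subtype.val ⁻¹' B) = posterior (P.map fun ω => (X ω : ℝ)) σ r y B := by
  have hmap : (P.map fun ω => (X ω : ℝ)) = (P.map X).map Subtype.val :=
    (Measure.map_map measurable_subtype_coe hX).symm
  have hw : Measurable fun x => bayesWeight σ r y x := by
    have h : Measurable fun x : ℝ => ((r, y), x) := measurable_prodMk_left
    exact (measurable_bayesWeight σ).comp h
  have hmass : ∀ C : Set ℝ, MeasurableSet C →
      posteriorMass (P.map fun ω => (X ω : ℝ)) σ r y C =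
        ∫⁻ x : 𝕏 in Subtype.val ⁻¹' C, bayesWeight σ r y x ∂P.map X := by
    intro C hC
    rw [posteriorMass, hmap, setLIntegral_map hC hw measurable_subtype_coe]
  have hg : ∀ x : 𝕏, ENNReal.ofReal (∏ i, gaussianWeight x (y i) (r i) (σ i)) =
      bayesWeight σ r y x := fun x => by rw [bayesWeight]
  rw [posterior, hmass B hB, hmass _ MeasurableSet.univ, normalizedWeight, Measure.smul_apply,
    withDensity_apply _ (measurable_subtype_coe hB), smul_eq_mul, mul_comm, ← div_eq_mul_inv]
  simp only [hg, Set.preimage_univ, Measure.restrict_univ]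

/-- The defining property of conditional expectation, for any `m` containing the raw σ-algebra:
`hraw` gives measurability of the version, `hint` the integrals. It serves both filtrations. -/
theorem isCondDistribGiven_of_setLIntegral [IsProbabilityMeasure P] (hX : Measurable X)
    (hσ : ∀ i, 0 < σ i) (hβ : ∀ i, IsBrownianBridge P (β i))
    (hββ : iIndepFun (fun i ω t => β i t ω) P)
    (hXβ : IndepFun (fun ω => (X ω : ℝ)) (fun ω i t => β i t ω) P)
    (hJ : IsSwitchingProcess P J)
    (hJξ : IndepFun (fun ω t => J t ω)
      (fun ω i t => infoProcess (fun ω => (X ω : ℝ)) σ β i t ω) P)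
    (ht : t < 1) (hm : m ≤ mΩ)
    (hraw : modulatedSigma (fun ω => (X ω : ℝ)) J (infoProcess (fun ω => (X ω : ℝ)) σ β) t ≤ m)
    (hint : ∀ B : Set ℝ, MeasurableSet B → ∀ G : Set Ω, MeasurableSet[m] G →
      ∫⁻ ω in G, B.indicator 1 (X ω : ℝ) ∂P =
        ∫⁻ ω in G, posteriorAt P (fun ω => (X ω : ℝ)) σ β J t B ω ∂P) :
    IsCondDistribGiven P m X fun ω => normalizedWeight (P.map X) fun x =>
      ∏ i, gaussianWeight x
        (infoProcess (fun ω => (X ω : ℝ)) σ β i (lastActive J i t ω) ω)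
        (lastActive J i t ω) (σ i) := by
  have hX' : Measurable fun ω => (X ω : ℝ) := hX.subtype_val
  have hprobX : IsProbabilityMeasure (P.map fun ω => (X ω : ℝ)) :=
    Measure.isProbabilityMeasure_map hX'.aemeasurable
  have hκ : ∀ ω, ∀ B : Set ℝ, MeasurableSet B →
      normalizedWeight (P.map X) (fun x : 𝕏 => ∏ i, gaussianWeight x
        (infoProcess (fun ω => (X ω : ℝ)) σ β i (lastActive J i t ω) ω)
        (lastActive J i t ω) (σ i)) (Subtype.val ⁻¹' B) =
      posteriorAt P (fun ω => (X ω : ℝ)) σ β J t B ω := by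
    intro ω B hB
    simp only [posteriorAt, ← lastActive_eq_lastOne]
    exact normalizedWeight_preimage_coe hX σ (fun i => lastActive J i t ω)
      (fun i => infoProcess (fun ω => (X ω : ℝ)) σ β i (lastActive J i t ω) ω) hB
  refine ⟨?_, ?_⟩
  · filter_upwards [ae_posteriorMass_ne_top hX' hσ hβ hββ hXβ hJ hJξ ht] with ω hω
    refine ⟨?_⟩
    rw [← Set.preimage_univ, hκ ω _ MeasurableSet.univ, posteriorAt, posterior,
      ENNReal.div_self (posteriorMass_univ_ne_zero _ _) hω]
  -- The σ-algebra of the subtype consists of traces of Borel sets of `ℝ`.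
  · rintro _ ⟨B, hB, rfl⟩
    have hpost := aemeasurable_posteriorAt (σ := σ) hX' hβ hJ t B
    have hle1 : ∀ ω, posteriorAt P (fun ω => (X ω : ℝ)) σ β J t B ω ≤ 1 := fun ω =>
      posterior_le_one _ _ _
    have hreal : (fun ω => (normalizedWeight (P.map X) fun x : 𝕏 => ∏ i, gaussianWeight x
        (infoProcess (fun ω => (X ω : ℝ)) σ β i (lastActive J i t ω) ω)
        (lastActive J i t ω) (σ i)).real (Subtype.val ⁻¹' B)) =
        fun ω => (posteriorAt P (fun ω => (X ω : ℝ)) σ β J t B ω).toReal := by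
      ext ω
      rw [Measure.real, hκ ω B hB]
    rw [hreal]
    have hXB : MeasurableSet (X ⁻¹' (Subtype.val ⁻¹' B)) := hX (measurable_subtype_coe hB)
    have hbdd : Integrable
        (fun ω => (posteriorAt P (fun ω => (X ω : ℝ)) σ β J t B ω).toReal) P := by
      refine Integrable.of_bound hpost.ennreal_toReal.aestronglyMeasurable 1
        (ae_of_all _ fun ω => ?_)
      rw [Real.norm_of_nonneg ENNReal.toReal_nonneg]
      exact ENNReal.toReal_le_of_le_ofReal zero_le_one (by simpa using hle1 ω)
    refine (ae_eq_condExp_of_forall_setIntegral_eq hm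
      ((integrable_const (1 : ℝ)).indicator hXB) (fun s _ _ => hbdd.integrableOn)
      (fun G hG _ => ?_) ?_).symm
    · rw [integral_toReal hpost.restrict
        (ae_of_all _ fun ω => (hle1 ω).trans_lt ENNReal.one_lt_top), ← hint B hB G hG,
        ← integral_toReal]
      · refine integral_congr_ae (ae_of_all _ fun ω => ?_)
        by_cases h : (X ω : ℝ) ∈ B <;> simp [Set.indicator, h]
      · exact ((measurable_one.indicator hB).comp hX').aemeasurable
      · refine ae_of_all _ fun ω => lt_of_le_of_lt (Set.indicator_le_self _ _ _) ?_
        simp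
    · refine ⟨_, ((measurable_observed_posterior (P := P) (fun ω => (X ω : ℝ)) σ β J t B).mono
        hraw le_rfl).ennreal_toReal.stronglyMeasurable, ?_⟩
      filter_upwards [posteriorAt_ae_eq (X := fun ω => (X ω : ℝ)) (σ := σ) hβ hJ t B] with ω hω
      rw [hω]

end CondDistrib

end ModulatedInfo

theorem mainTheorem5 {Ω : Type*} [mΩ : MeasurableSpace Ω] (P : Measure Ω)
    [IsProbabilityMeasure P] {n : ℕ} {𝕏 : Set ℝ} (X : Ω → 𝕏) (hX : Measurable X)
    (hX2 : MemLp (fun ω => (X ω : ℝ)) 2 P)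
    (σ : Fin n → ℝ) (hσ : ∀ i, 0 < σ i)
    (β : Fin n → unitInterval → Ω → ℝ)
    (hβ : ∀ i, ModulatedInfo.IsBrownianBridge P (β i))
    -- the signal and the bridges are mutually independent
    (hββ : iIndepFun (fun i ω t => β i t ω) P)
    (hXβ : IndepFun X (fun ω i t => β i t ω) P)
    -- the switching process, independent of the information process
    (J : unitInterval → Ω → Fin n → ℝ) (hJ : ModulatedInfo.IsSwitchingProcess P J)
    (hJξ : IndepFun (fun ω t => J t ω)
      (fun ω i t => ModulatedInfo.infoProcess (fun ω => (X ω : ℝ)) σ β i t ω) P)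
    (t : unitInterval) (ht : t < 1) :
    let ν : Measure 𝕏 := P.map X
    let ξ : Fin n → unitInterval → Ω → ℝ :=
      ModulatedInfo.infoProcess (fun ω => (X ω : ℝ)) σ β
    let τ : Fin n → Ω → unitInterval := fun i ω => ModulatedInfo.lastActive J i t ω
    let 𝓕raw : Filtration unitInterval mΩ :=
      ModulatedInfo.rawFiltration (fun ω => (X ω : ℝ)) J ξ hX.subtype_val hJ.measurable
        (ModulatedInfo.measurable_infoProcess hX.subtype_val σ hβ)
    let 𝓕 : Filtration unitInterval mΩ := ModulatedInfo.usualAugmentation P 𝓕raw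
    let νt : Ω → Measure 𝕏 := fun ω => ModulatedInfo.normalizedWeight ν fun x =>
      ∏ i, ModulatedInfo.gaussianWeight x (ξ i (τ i ω) ω) (τ i ω) (σ i)
    ModulatedInfo.IsCondDistribGiven P (𝓕 t) X νt ∧
      ModulatedInfo.IsCondDistribGiven P (𝓕raw t) X νt := by
  have hX' : Measurable fun ω => (X ω : ℝ) := hX.subtype_val
  have hXβ' : IndepFun (fun ω => (X ω : ℝ)) (fun ω i t => β i t ω) P :=
    hXβ.comp measurable_subtype_coe measurable_id
  intro ν ξ τ 𝓕raw 𝓕 νt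
  have hle : 𝓕raw ≤ 𝓕 := le_sup_left.trans (Filtration.le_rightCont _)
  exact ⟨ModulatedInfo.isCondDistribGiven_of_setLIntegral hX hσ hβ hββ hXβ' hJ hJξ ht (𝓕.le t)
      (hle t) fun B hB G hG =>
        ModulatedInfo.setLIntegral_posteriorAt_of_augmentation hX' hσ hβ hββ hXβ' hJ hJξ ht hB hG,
    ModulatedInfo.isCondDistribGiven_of_setLIntegral hX hσ hβ hββ hXβ' hJ hJξ ht (𝓕raw.le t)
      le_rfl fun B hB G hG =>
        ModulatedInfo.setLIntegral_posteriorAt_of_modulatedSigma hX' hσ hβ hββ hXβ' hJ hJξ ht hB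
          hG⟩
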